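/- Let $\mathbb K=\mathbb R$ or $\mathbb C$, and let $\mathfrak g$ be a finite-dimensional Lie algebra over $\mathbb K$. Write $\mathrm{ad}^*_x\colon\mathfrak g^*\to\mathfrak g^*$ for the adjoint of $\mathrm{ad}_x$, i.e. $\langle \mathrm{ad}^*_x\xi,y\rangle=\langle\xi,[x,y]\rangle$, and $\mathcal A(\mathfrak g^*,\mathfrak g)$ for the space of skew-symmetric linear maps $\mathfrak g^*\to\mathfrak g$. A Lie quasi-bialgebra $\mathcal G=(\mathfrak g,[\,,],\varpi,\varphi)$ consists of a linear map $\varpi\colon\mathfrak g\to\mathcal A(\mathfrak g^*,\mathfrak g)$ with $\varpi_{[x,y]}=\mathrm{ad}_x\varpi_y+\varpi_y\mathrm{ad}^*_x-\mathrm{ad}_y\varpi_x-\varpi_x\mathrm{ad}^*_y$ and of $\varphi\in\wedge^3\mathfrak g$ such that $\mathfrak g\oplus\mathfrak g^*$, with the skew-symmetric bracket extending that of $\mathfrak g$ and given by $[x,\xi]=\varpi_x\xi-\mathrm{ad}^*_x\xi$ and $[\xi,\eta]=\langle\eta,\varpi_\bullet\xi\rangle+\langle\xi\otimes\eta\otimes1,\varphi\rangle$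 for $x\in\mathfrak g$, $\xi,\eta\in\mathfrak g^*$, is a Lie algebra. Let $\mathfrak l\subset\mathfrak g$ be a Lie subalgebra with inclusion $i$ and let $\mathbb D$ be the formal neighbourhood of $0$ in $\mathfrak l^*$. A formal dynamical $\ell$-matrix (at $0$) associated with $\mathcal G$ is a formal map $l\colon\mathbb D\to\mathcal A(\mathfrak g^*,\mathfrak g)$, $p\mapsto l_p$ (a formal power series), such that, formally in $p$, for all $\xi,\eta,\zeta\in\mathfrak g^*$ and $z\in\mathfrak l$, $$\sum_{\mathrm{cyc}(\xi,\eta,\zeta)}\Big(\langle\zeta,d_pl(i^*\xi)\eta\rangle-\langle\zeta,[l_p\xi,l_p\eta]\rangle-\langle\zeta,\varpi_{l_p\xi}\eta\rangle\Big)=\langle\xi\otimes\eta\otimes\zeta,\varphi\rangle,$$ $$d_pl(\mathrm{ad}^*_zp)+\varpi_{iz}+\mathrm{ad}_{iz}l_p+l_p\,\mathrm{ad}^*_{iz}=0.$$ Let $G$ be a Lie group with Lie algebra $\mathfrak g$. The formal gauge group $\mathrm{Map}_0(\mathbb D,G)^{\mathfrak l}$ consists of the formal maps $\sigma\colon\mathbb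 D\to G$ with $\sigma_0=1$, i.e. $\sigma=e^{\Sigma}$ with $\Sigma\colon\mathbb D\to\mathfrak g$ a formal map and $\Sigma_0=0$, that are $\mathfrak l$-equivariant: $R_p(\mathrm{ad}^*_zp)=\mathrm{Ad}_{\sigma_p}z-z$ for all $z\in\mathfrak l$, where $R_p=r_{\sigma_p^{-1}}(T_p\sigma)=\frac{e^{\mathrm{ad}_{\Sigma_p}}-1}{\mathrm{ad}_{\Sigma_p}}\circ d_p\Sigma\colon\mathfrak l^*\to\mathfrak g$ is the right logarithmic derivative of $\sigma$. The gauge transform of $l$ by $\sigma$ is $$l^\sigma_p=\mathrm{Ad}_{\sigma_p}l_p\mathrm{Ad}^*_{\sigma_p}+R_p\,i^*\mathrm{Ad}^*_{\sigma_p}-i\,R_p^*+\pi_{\sigma_p},$$ where $\mathrm{Ad}^*_{\sigma_p}$ is the adjoint of $\mathrm{Ad}_{\sigma_p}$, $R_p^*\colon\mathfrak g^*\to\mathfrak l^{**}=\mathfrak l$ is the adjoint of $R_p$, and $\pi$ is the (local) group $1$-cocycle integrating $\varpi$, given by $\pi_{e^x}=\sum_{k\ge0}\frac1{(k+1)!}\rho_x^k(\varpi_x)$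 with $\rho_x(t)=\mathrm{ad}_xt+t\,\mathrm{ad}^*_x$. **Theorem.** Let $\mathcal G=(\mathfrak g,[\,,],\varpi,\varphi)$ be a Lie quasi-bialgebra and let $\mathfrak g=\mathfrak l\oplus\mathfrak m$ be a reductive decomposition, i.e. $\mathfrak l$ is a Lie subalgebra, $\mathfrak m$ is a complementary linear subspace and $[\mathfrak l,\mathfrak m]\subset\mathfrak m$. Assume that $\varpi_z=0$ for all $z\in\mathfrak l$. Let $l$ and $l'$ be two formal dynamical $\ell$-matrices at $0$ associated with $\mathcal G$ such that $l_0=l'_0$. Then there exists $\sigma\in\mathrm{Map}_0(\mathbb D,G)^{\mathfrak l}$ such that $l^\sigma=l'$. -/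

import Mathlib

open Module

noncomputable section

/-- Formal maps from the formal neighbourhood of `0` in a vector space with linear coordinates
`x i`, `i : ι`, to the vector space `V`: formal power series in the `x i` with coefficients in
`V`. The value of `F` at the monomial exponent `n` is the coefficient of `x ^ n`; in particular
`F 0` is the value of the formal map at the point `0`. -/
abbrev FormalMap (ι : Type*) (V : Type*) : Type _ := (ι →₀ ℕ) → V

namespace FormalMap

section Basic

variable {𝕜 : Type*} [Field 𝕜] {ι : Type*} [Fintype ι] [DecidableEq ι]
  {V W X : Type*} [AddCommGroup V] [Module 𝕜 V] [AddCommGroup W] [Module 𝕜 W]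
  [AddCommGroup X] [Module 𝕜 X]

/-- The constant formal map. -/
def const (ι : Type*) [DecidableEq ι] {V : Type*} [AddCommGroup V] (v : V) : FormalMap ι V :=
  fun n => if n = 0 then v else 0

/-- Composition `p ↦ f (F p)` of a formal map with a linear map. -/
def map (f : V →ₗ[𝕜] W) (F : FormalMap ι V) : FormalMap ι W := fun n => f (F n)

/-- The formal map `p ↦ B (F p) (G p)` for a bilinear map `B` (Cauchy product). -/
def bilin (B : V →ₗ[𝕜] W →ₗ[𝕜] X) (F : FormalMap ι V) (G : FormalMap ι W) : FormalMap ι X :=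
  fun n => ∑ q ∈ Finset.HasAntidiagonal.antidiagonal n, B (F q.1) (G q.2)

/-- The formal map `p ↦ F p (G p)` when `F` takes values in linear maps. -/
def apply (F : FormalMap ι (V →ₗ[𝕜] W)) (G : FormalMap ι V) : FormalMap ι W :=
  bilin (LinearMap.id : (V →ₗ[𝕜] W) →ₗ[𝕜] (V →ₗ[𝕜] W)) F G

/-- The formal map `p ↦ F p ∘ G p` for `F`, `G` with values in linear maps. -/
def comp (F : FormalMap ι (W →ₗ[𝕜] X)) (G : FormalMap ι (V →ₗ[𝕜] W)) :
    FormalMap ι (V →ₗ[𝕜] X) :=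
  bilin (LinearMap.llcomp 𝕜 V W X) F G

/-- The pointwise power `p ↦ (T p) ^ k` of a formal map with values in endomorphisms. -/
def pow (T : FormalMap ι (V →ₗ[𝕜] V)) : ℕ → FormalMap ι (V →ₗ[𝕜] V)
  | 0 => const ι LinearMap.id
  | k + 1 => comp T (pow T k)

/-- The formal map `p ↦ ∑ k, c k • (T p) ^ k`, for `T` with `T 0 = 0`. As `T` has no constant
term, only the powers `k ≤ |n|` contribute to the coefficient of `x ^ n`. -/
def series (c : ℕ → 𝕜) (T : FormalMap ι (V →ₗ[𝕜] V)) : FormalMap ι (V →ₗ[𝕜] V) :=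
  fun n => ∑ k ∈ Finset.range (n.degree + 1), c k • pow T k n

/-- `e ^ T`, for `T` with `T 0 = 0`. -/
def exp (T : FormalMap ι (V →ₗ[𝕜] V)) : FormalMap ι (V →ₗ[𝕜] V) :=
  series (fun k => ((k.factorial : 𝕜))⁻¹) T

/-- `(e ^ T - 1) / T = ∑ k, T ^ k / (k + 1)!`, for `T` with `T 0 = 0`. -/
def expDiv (T : FormalMap ι (V →ₗ[𝕜] V)) : FormalMap ι (V →ₗ[𝕜] V) :=
  series (fun k => (((k + 1).factorial : 𝕜))⁻¹) T

/-- The partial derivative of a formal map with respect to the coordinate `x i`. -/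
def pderiv (𝕜 : Type*) [Field 𝕜] {ι : Type*} {V : Type*} [AddCommGroup V] [Module 𝕜 V]
    (i : ι) (F : FormalMap ι V) : FormalMap ι V :=
  fun n => ((n i : 𝕜) + 1) • F (n + Finsupp.single i 1)

end Basic

section Dual

/-! Formal maps on the formal neighbourhood of `0` in the dual `E*` of a vector space `E` with
basis `b`. The coordinates on `E*` are `x i (p) = p (b i)`. -/

variable {𝕜 : Type*} [Field 𝕜] {ι : Type*} [Fintype ι] [DecidableEq ι]
  {E V : Type*} [AddCommGroup E] [Module 𝕜 E] [AddCommGroup V] [Module 𝕜 V]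

/-- The tautological formal map `p ↦ p`, `p ∈ E*`. -/
def point (b : Basis ι 𝕜 E) : FormalMap ι (Dual 𝕜 E) :=
  fun n => ∑ i, if n = Finsupp.single i 1 then b.coord i else 0

/-- The differential `p ↦ d_p F ∈ L(E*, V)` of a formal map `F` on `E*`:
`d_p F (α) = ∑ i, α (b i) • ∂F / ∂x i (p)`. -/
def differential (b : Basis ι 𝕜 E) (F : FormalMap ι V) : FormalMap ι (Dual 𝕜 E →ₗ[𝕜] V) :=
  fun n => ∑ i, (Dual.eval 𝕜 E (b i)).smulRight (pderiv 𝕜 i F n)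

/-- The derivative `p ↦ d_p F (α)` of `F` in the constant direction `α ∈ E*`. -/
def dirDeriv (b : Basis ι 𝕜 E) (F : FormalMap ι V) (α : Dual 𝕜 E) : FormalMap ι V :=
  fun n => differential b F n α

end Dual

end FormalMap

section LieQuasiBialgebras

variable (𝕜 : Type*) [Field 𝕜] {g : Type*} [LieRing g] [LieAlgebra 𝕜 g]

/-- The adjoint `ad*_x : g* → g*` of `ad_x`, that is `⟨ad*_x ξ, y⟩ = ⟨ξ, [x, y]⟩`. -/
def adStar (x : g) : Dual 𝕜 g →ₗ[𝕜] Dual 𝕜 g := (LieAlgebra.ad 𝕜 g x).dualMap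

/-- The action of `x ∈ g` on linear maps `t : g* → g`, that is `t ↦ ad_x t + t ad*_x`, as a
linear map in `x`. -/
def adjAction (g : Type*) [LieRing g] [LieAlgebra 𝕜 g] :
    g →ₗ[𝕜] (Dual 𝕜 g →ₗ[𝕜] g) →ₗ[𝕜] (Dual 𝕜 g →ₗ[𝕜] g) :=
  LinearMap.mk₂ 𝕜 (fun x t => (LieAlgebra.ad 𝕜 g x).comp t + t.comp (adStar 𝕜 x))
    (by intro x y t; ext ξ
        have h : adStar 𝕜 (x + y) ξ = adStar 𝕜 x ξ + adStar 𝕜 y ξ := by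
          ext v; simp [adStar]
        simp [h]; abel)
    (by intro c x t; ext ξ
        have h : adStar 𝕜 (c • x) ξ = c • adStar 𝕜 x ξ := by
          ext v; simp [adStar]
        simp [h])
    (by intro x s t; ext ξ; simp; abel)
    (by intro c x t; ext ξ; simp)

variable {𝕜}

/-- Skew-symmetric linear maps `g* → g`: `⟨ξ, t η⟩ = - ⟨η, t ξ⟩`. -/
def IsSkew {g : Type*} [AddCommGroup g] [Module 𝕜 g] (t : Dual 𝕜 g →ₗ[𝕜] g) : Prop :=
  ∀ ξ η : Dual 𝕜 g, ξ (t η) = - η (t ξ)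

/-- The element `⟨ξ ⊗ η ⊗ 1, φ⟩` of `g`, where `φ ∈ ⋀³ g` is given as the alternating trilinear
form `(ξ, η, ζ) ↦ ⟨ξ ⊗ η ⊗ ζ, φ⟩` on `g*`: the vector with
`⟨ζ, ⟨ξ ⊗ η ⊗ 1, φ⟩⟩ = ⟨ξ ⊗ η ⊗ ζ, φ⟩`. -/
def contract [FiniteDimensional 𝕜 g] (φ : Dual 𝕜 g [⋀^Fin 3]→ₗ[𝕜] 𝕜)
    (ξ η : Dual 𝕜 g) : g :=
  (evalEquiv 𝕜 g).symm (φ.toMultilinearMap.toLinearMap ![ξ, η, 0] 2)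

/-- The bracket on `d = g ⊕ g*` defined by `[x, y]_d = [x, y]`, `[x, ξ]_d = ϖ_x ξ - ad*_x ξ` and
`[ξ, η]_d = ⟨η, ϖ_• ξ⟩ + ⟨ξ ⊗ η ⊗ 1, φ⟩`, extended skew-symmetrically. -/
def doubleBracket [FiniteDimensional 𝕜 g] (ϖ : g →ₗ[𝕜] Dual 𝕜 g →ₗ[𝕜] g)
    (φ : Dual 𝕜 g [⋀^Fin 3]→ₗ[𝕜] 𝕜) (u v : g × Dual 𝕜 g) : g × Dual 𝕜 g :=
  (⁅u.1, v.1⁆ + ϖ u.1 v.2 - ϖ v.1 u.2 + contract φ u.2 v.2,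
    - adStar 𝕜 u.1 v.2 + adStar 𝕜 v.1 u.2 + v.2 ∘ₗ ϖ.flip u.2)

variable (𝕜 g)

/-- A Lie quasi-bialgebra structure on the Lie algebra `g`: a `1`-cocycle `ϖ` with values in the
skew-symmetric maps `g* → g`, and `φ ∈ ⋀³ g` (as an alternating trilinear form on `g*`), such
that `g ⊕ g*` with the bracket above is a Lie algebra. -/
structure LieQuasiBialgebra [FiniteDimensional 𝕜 g] where
  ϖ : g →ₗ[𝕜] Dual 𝕜 g →ₗ[𝕜] g
  φ : Dual 𝕜 g [⋀^Fin 3]→ₗ[𝕜] 𝕜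
  skew : ∀ x, IsSkew (ϖ x)
  cocycle : ∀ x y : g, ϖ ⁅x, y⁆ = adjAction 𝕜 g x (ϖ y) - adjAction 𝕜 g y (ϖ x)
  bracket_self : ∀ u, doubleBracket ϖ φ u u = 0
  jacobi : ∀ u v w, doubleBracket ϖ φ u (doubleBracket ϖ φ v w)
    + doubleBracket ϖ φ v (doubleBracket ϖ φ w u)
    + doubleBracket ϖ φ w (doubleBracket ϖ φ u v) = 0

variable {𝕜 g}

/-- `g = l ⊕ m` is a reductive decomposition: `l` is a subalgebra, `m` a complementary subspace
and `[l, m] ⊆ m`. -/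
structure IsReductiveDecomposition (l : LieSubalgebra 𝕜 g) (m : Submodule 𝕜 g) : Prop where
  isCompl : IsCompl l.toSubmodule m
  lie_mem : ∀ z ∈ l, ∀ x ∈ m, ⁅z, x⁆ ∈ m

end LieQuasiBialgebras

section Dynamical

open FormalMap

variable {𝕜 : Type*} [Field 𝕜] {g : Type*} [LieRing g] [LieAlgebra 𝕜 g]
  [FiniteDimensional 𝕜 g] {l : LieSubalgebra 𝕜 g}
  {ι : Type*} [Fintype ι] [DecidableEq ι]

/-- The restriction `i* : g* → l*`, adjoint of the inclusion `i : l → g`. -/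
def restrictDual (l : LieSubalgebra 𝕜 g) : Dual 𝕜 g →ₗ[𝕜] Dual 𝕜 l :=
  l.toSubmodule.subtype.dualMap

/-- The formal map `p ↦ ad*_z p` from `l*` to `l*`, for `z ∈ l`. -/
def adStarPoint (b : Basis ι 𝕜 l) (z : l) : FormalMap ι (Dual 𝕜 l) :=
  map (adStar 𝕜 z) (point b)

/-- The formal map `p ↦ ⟨ζ, d_p r (i* ξ) η⟩ - ⟨ζ, [r_p ξ, r_p η]⟩ - ⟨ζ, ϖ_{r_p ξ} η⟩`. -/
def cdybeTerm (G : LieQuasiBialgebra 𝕜 g) (b : Basis ι 𝕜 l)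
    (r : FormalMap ι (Dual 𝕜 g →ₗ[𝕜] g)) (ξ η ζ : Dual 𝕜 g) : FormalMap ι 𝕜 :=
  fun n => ζ (dirDeriv b r (restrictDual l ξ) n η)
    - ζ (bilin (LieAlgebra.ad 𝕜 g : g →ₗ[𝕜] g →ₗ[𝕜] g) (fun k => r k ξ) (fun k => r k η) n)
    - ζ (G.ϖ (r n ξ) η)

/-- Formal dynamical `ℓ`-matrices at `0 ∈ l*` associated with the Lie quasi-bialgebra `G`: formal
maps from the formal neighbourhood of `0` in `l*` to the skew-symmetric maps `g* → g` that
satisfy the generalised classical dynamical Yang--Baxter equation and `l`-equivariance. -/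
structure IsFormalDynamicalMatrix (G : LieQuasiBialgebra 𝕜 g) (b : Basis ι 𝕜 l)
    (r : FormalMap ι (Dual 𝕜 g →ₗ[𝕜] g)) : Prop where
  skew : ∀ n, IsSkew (r n)
  cdybe : ∀ ξ η ζ : Dual 𝕜 g,
    cdybeTerm G b r ξ η ζ + cdybeTerm G b r η ζ ξ + cdybeTerm G b r ζ ξ η
      = const ι (G.φ ![ξ, η, ζ])
  equivariant : ∀ z : l,
    apply (differential b r) (adStarPoint b z) + const ι (G.ϖ z)
      + map (adjAction 𝕜 g z) r = 0

/-! Formal maps `σ` from the formal neighbourhood of `0` in `l*` to a Lie group with Lie algebra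
`g` such that `σ_0 = 1`. They are given in exponential coordinates, `σ = e ^ S` with `S` a formal
map to `g` such that `S_0 = 0`. -/

/-- `Ad_σ = e ^ (ad_S)` for `σ = e ^ S`. -/
def formalAd (S : FormalMap ι g) : FormalMap ι (g →ₗ[𝕜] g) :=
  exp (map (LieAlgebra.ad 𝕜 g : g →ₗ[𝕜] g →ₗ[𝕜] g) S)

/-- The adjoint `Ad*_σ : g* → g*` of `Ad_σ`. -/
def formalAdStar (S : FormalMap ι g) : FormalMap ι (Dual 𝕜 g →ₗ[𝕜] Dual 𝕜 g) :=
  map (Dual.transpose (R := 𝕜)) (formalAd (𝕜 := 𝕜) S)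

/-- The right logarithmic derivative `r_{σ_p⁻¹} (T_p σ) : l* → g`, which for `σ = e ^ S` is
`((e ^ (ad_S) - 1) / ad_S) ∘ d_p S`. -/
def rightLogDeriv (b : Basis ι 𝕜 l) (S : FormalMap ι g) : FormalMap ι (Dual 𝕜 l →ₗ[𝕜] g) :=
  comp (expDiv (map (LieAlgebra.ad 𝕜 g : g →ₗ[𝕜] g →ₗ[𝕜] g) S)) (differential b S)

/-- For `A : l* → g`, the map `i ∘ A* : g* → g`, where `A* : g* → l** = l` is the adjoint. -/
def inclAdjoint (l : LieSubalgebra 𝕜 g) :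
    (Dual 𝕜 l →ₗ[𝕜] g) →ₗ[𝕜] (Dual 𝕜 g →ₗ[𝕜] g) :=
  (LinearMap.llcomp 𝕜 (Dual 𝕜 g) (Dual 𝕜 (Dual 𝕜 l)) g
      (l.toSubmodule.subtype ∘ₗ (evalEquiv 𝕜 l).symm.toLinearMap))
    ∘ₗ Dual.transpose (R := 𝕜)

/-- `θ^σ_p = r_{σ_p⁻¹} (T_p σ) i* Ad*_{σ_p} - i (T_p σ)* r*_{σ_p⁻¹}`. -/
def theta (b : Basis ι 𝕜 l) (S : FormalMap ι g) :
    FormalMap ι (Dual 𝕜 g →ₗ[𝕜] g) :=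
  comp (rightLogDeriv b S) (comp (const ι (restrictDual l)) (formalAdStar S))
    - map (inclAdjoint l) (rightLogDeriv b S)

/-- `π_σ`, where `π` is the group `1`-cocycle (`π_{gh} = π_g + Ad_g π_h Ad*_g`) integrating the Lie
algebra `1`-cocycle `ϖ`. For `x ∈ g` one has
`π_{e ^ x} = ∫ t in 0..1, e ^ (t ad_x) ϖ_x e ^ (t ad*_x) = ((e ^ ρ_x - 1) / ρ_x) ϖ_x`,
where `ρ_x t = ad_x t + t ad*_x`. -/
def formalGroupCocycle (G : LieQuasiBialgebra 𝕜 g) (S : FormalMap ι g) :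
    FormalMap ι (Dual 𝕜 g →ₗ[𝕜] g) :=
  apply (expDiv (map (adjAction 𝕜 g) S)) (map G.ϖ S)

/-- The formal gauge group: `l`-equivariant formal maps `σ = e ^ log` with `σ_0 = 1`. The
equivariance is `r_{σ_p⁻¹} (T_p σ) (ad*_z p) = Ad_{σ_p} z - z` for `z ∈ l`. -/
structure GaugeMap (b : Basis ι 𝕜 l) where
  log : FormalMap ι g
  log_zero : log 0 = 0
  equivariant : ∀ z : l,
    apply (rightLogDeriv b log) (adStarPoint b z)
      = apply (formalAd (𝕜 := 𝕜) log) (const ι (z : g)) - const ι (z : g)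

/-- The gauge transform `r^σ_p = Ad_{σ_p} r_p Ad*_{σ_p} + θ^σ_p + π_{σ_p}`. -/
def gaugeTransform (G : LieQuasiBialgebra 𝕜 g) (b : Basis ι 𝕜 l)
    (σ : GaugeMap b) (r : FormalMap ι (Dual 𝕜 g →ₗ[𝕜] g)) : FormalMap ι (Dual 𝕜 g →ₗ[𝕜] g) :=
  comp (formalAd σ.log) (comp r (formalAdStar σ.log)) + theta b σ.log
    + formalGroupCocycle G σ.log

end Dynamical

end

open Module

noncomputable section

set_option linter.unusedSectionVars false

namespace FormalMap

/-! ### Reindexing of Cauchy products. -/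

section Antidiagonal

open Finset.HasAntidiagonal (antidiagonal mem_antidiagonal)

variable {ι : Type*} [DecidableEq ι] {A : Type*} [AddCommMonoid A]

/-! It is enough to use gauge maps e^S with S_0 = 0 whose logarithm is linearly equivariant, d_p
S(ad*_z p) = [S_p, z] (`IsEquivariant`). Write ρ for `adjAction` and c_S = dS i* - i (dS)* + ϖ_S for
`gaugeSource`. For such S, the gauge transform of r by e^S is the value at t = 1 of the solution of
the affine equation F' = ρ_S F + c_S with F(0) = r (`gaugeTransform_eq_affineFlow`). Because S has
no constant term, each coefficient of the solution is polynomial in t, and uniqueness is an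
induction on the degree. Identities between group-like expressions are thus checked by
differentiating in t.

This flow preserves dynamical matrices (`IsFormalDynamicalMatrix.affineFlow`). By
`cyclic_cdybeVariation_gauge` the defect of the Yang--Baxter equation evolves by the coadjoint
action of S on its three arguments. Since S_0 = 0, the derivative of a coefficient of the defect
involves only coefficients of lower degree, so a defect that vanishes at t = 0 vanishes for all t.

The gauge map is then built degree by degree. Suppose that the transform L of r agrees with r' up to
degree k. The part Δ of r' - L of degree N = k + 1 is skew and equivariant, and closed: the cyclic
sum of ⟨ζ, dΔ(i*ξ)η⟩ is zero, because the other terms of the equation agree at this order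
(`closed_component`). Along g = l ⊕ m, Δ has three blocks. Its ∧²m block has zero derivative, hence
is zero since N > 0; this is why only the values at 0 must be assumed equal. The mixed block is a
closed m-valued 1-form on l*, and the ∧²l block is a closed 2-form on l*. The Poincaré lemma
(`skewPart_differential_homotopy`) gives Δ = ds i* - i (ds)*, with s equivariant of degree k + 2
because the decomposition is reductive. Replacing S by S + s changes the transform up to degree k +
1 by exactly this amount (`affineFlow_sub_affineFlow`), and the successive logarithms converge
coefficientwise. -/

theorem sum_antidiagonal_assoc (f : (ι →₀ ℕ) → (ι →₀ ℕ) → (ι →₀ ℕ) → A) (n : ι →₀ ℕ) :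
    ∑ q ∈ antidiagonal n, ∑ r ∈ antidiagonal q.1, f r.1 r.2 q.2
      = ∑ q ∈ antidiagonal n, ∑ r ∈ antidiagonal q.2, f q.1 r.1 r.2 := by
  simp only [Finset.sum_sigma']
  apply Finset.sum_nbij' (fun ⟨⟨_i, j⟩, ⟨k, l⟩⟩ ↦ ⟨(k, l + j), (l, j)⟩)
    (fun ⟨⟨i, _j⟩, ⟨k, l⟩⟩ ↦ ⟨(i + k, l), (i, k)⟩)
  all_goals
    rintro ⟨⟨i, j⟩, ⟨k, l⟩⟩ h
    simp only [Finset.mem_sigma, mem_antidiagonal] at h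
    obtain ⟨h1, h2⟩ := h
    subst h1 h2
    simp [add_assoc]

theorem sum_antidiagonal_comm (f : (ι →₀ ℕ) → (ι →₀ ℕ) → A) (n : ι →₀ ℕ) :
    ∑ q ∈ antidiagonal n, f q.1 q.2 = ∑ q ∈ antidiagonal n, f q.2 q.1 :=
  Finset.sum_nbij' Prod.swap Prod.swap (by simp [add_comm]) (by simp [add_comm]) (by simp)
    (by simp) (by simp)

theorem sum_antidiagonal_right_comm (f : (ι →₀ ℕ) → (ι →₀ ℕ) → (ι →₀ ℕ) → A) (n : ι →₀ ℕ) :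
    ∑ q ∈ antidiagonal n, ∑ r ∈ antidiagonal q.1, f r.1 r.2 q.2
      = ∑ q ∈ antidiagonal n, ∑ r ∈ antidiagonal q.1, f r.1 q.2 r.2 := by
  rw [sum_antidiagonal_assoc, sum_antidiagonal_assoc (fun x y z => f x z y)]
  exact Finset.sum_congr rfl fun q _ => sum_antidiagonal_comm (fun y z => f q.1 y z) q.2

theorem sum_antidiagonal_left_comm (f : (ι →₀ ℕ) → (ι →₀ ℕ) → (ι →₀ ℕ) → A) (n : ι →₀ ℕ) :
    ∑ q ∈ antidiagonal n, ∑ r ∈ antidiagonal q.2, f q.1 r.1 r.2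
      = ∑ q ∈ antidiagonal n, ∑ r ∈ antidiagonal q.2, f r.1 q.1 r.2 := by
  rw [← sum_antidiagonal_assoc, ← sum_antidiagonal_assoc (fun x y z => f y x z)]
  exact Finset.sum_congr rfl fun q _ => sum_antidiagonal_comm (fun y z => f y z q.2) q.1

/-- Only the term `(0, n)` contributes to a sum over `antidiagonal n` if the other terms vanish. -/
theorem sum_antidiagonal_eq_zero_left (f : (ι →₀ ℕ) → (ι →₀ ℕ) → A) (n : ι →₀ ℕ)
    (h : ∀ q ∈ antidiagonal n, q.1 ≠ 0 → f q.1 q.2 = 0) :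
    ∑ q ∈ antidiagonal n, f q.1 q.2 = f 0 n := by
  rw [Finset.sum_eq_single (0, n)]
  · rintro ⟨a, c⟩ hq hne
    refine h _ hq fun h0 => hne ?_
    have := mem_antidiagonal.1 hq
    simp only at h0 this
    subst h0
    simp_all
  · intro hq; simp at hq

theorem degree_add_degree {n : ι →₀ ℕ} {q : (ι →₀ ℕ) × (ι →₀ ℕ)} (hq : q ∈ antidiagonal n) :
    q.1.degree + q.2.degree = n.degree := by
  rw [← mem_antidiagonal.1 hq, map_add]

/-- Shifting the first index by `single i 1` is a bijection onto the pairs with `q.1 i ≠ 0`, and the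
other pairs carry the coefficient 0. This is the core of the Leibniz rule for ∂/∂x_i. -/
theorem sum_antidiagonal_single_smul {𝕜 : Type*} [Semiring 𝕜] [Module 𝕜 A] (i : ι)
    (f : (ι →₀ ℕ) → (ι →₀ ℕ) → A) (n : ι →₀ ℕ) :
    ∑ q ∈ antidiagonal (n + Finsupp.single i 1), ((q.1 : ι →₀ ℕ) i : 𝕜) • f q.1 q.2
      = ∑ q ∈ antidiagonal n, (((q.1 : ι →₀ ℕ) i : 𝕜) + 1) • f (q.1 + Finsupp.single i 1) q.2 := by
  symm
  refine Finset.sum_of_injOn (fun q => (q.1 + Finsupp.single i 1, q.2)) ?_ ?_ ?_ ?_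
  · rintro ⟨a, c⟩ _ ⟨a', c'⟩ _ h
    simpa using h
  · rintro ⟨a, c⟩ h
    simp only [Finset.mem_coe, mem_antidiagonal] at h ⊢
    rw [← h]; abel
  · rintro ⟨a, c⟩ h h'
    by_cases ha : a i = 0
    · simp [ha]
    · exfalso
      apply h'
      have hle : Finsupp.single i 1 ≤ a := by
        rw [Finsupp.single_le_iff]; omega
      refine ⟨(a - Finsupp.single i 1, c), ?_, ?_⟩
      · simp only [Finset.mem_coe, mem_antidiagonal] at h ⊢
        apply add_right_cancel (b := Finsupp.single i 1)
        rw [← h, add_right_comm, tsub_add_cancel_of_le hle]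
      · simp [tsub_add_cancel_of_le hle]
  · rintro ⟨a, c⟩ _
    simp

end Antidiagonal

/-! ### Bilinear operations on formal maps. -/

section Basic

open Finset.HasAntidiagonal (antidiagonal mem_antidiagonal)

variable {𝕜 : Type*} [Field 𝕜] {ι : Type*} [DecidableEq ι]
  {V W X Y Z U : Type*} [AddCommGroup V] [Module 𝕜 V] [AddCommGroup W] [Module 𝕜 W]
  [AddCommGroup X] [Module 𝕜 X] [AddCommGroup Y] [Module 𝕜 Y] [AddCommGroup Z] [Module 𝕜 Z]
  [AddCommGroup U] [Module 𝕜 U]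

theorem const_apply (v : V) (n : ι →₀ ℕ) : const ι v n = if n = 0 then v else 0 := rfl

theorem map_apply (f : V →ₗ[𝕜] W) (F : FormalMap ι V) (n : ι →₀ ℕ) : map f F n = f (F n) := rfl

theorem bilin_apply (B : V →ₗ[𝕜] W →ₗ[𝕜] X) (F : FormalMap ι V) (G : FormalMap ι W)
    (n : ι →₀ ℕ) : bilin B F G n = ∑ q ∈ antidiagonal n, B (F q.1) (G q.2) := rfl

theorem apply_apply (F : FormalMap ι (V →ₗ[𝕜] W)) (G : FormalMap ι V) (n : ι →₀ ℕ) :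
    apply F G n = ∑ q ∈ antidiagonal n, F q.1 (G q.2) := rfl

theorem comp_apply (F : FormalMap ι (W →ₗ[𝕜] X)) (G : FormalMap ι (V →ₗ[𝕜] W)) (n : ι →₀ ℕ) :
    comp F G n = ∑ q ∈ antidiagonal n, F q.1 ∘ₗ G q.2 := rfl

theorem bilin_add_left (B : V →ₗ[𝕜] W →ₗ[𝕜] X) (F F' : FormalMap ι V) (G : FormalMap ι W) :
    bilin B (F + F') G = bilin B F G + bilin B F' G := by
  funext n; simp [bilin_apply, Finset.sum_add_distrib]

theorem bilin_add_right (B : V →ₗ[𝕜] W →ₗ[𝕜] X) (F : FormalMap ι V) (G G' : FormalMap ι W) :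
    bilin B F (G + G') = bilin B F G + bilin B F G' := by
  funext n; simp [bilin_apply, Finset.sum_add_distrib]

theorem bilin_sub_left (B : V →ₗ[𝕜] W →ₗ[𝕜] X) (F F' : FormalMap ι V) (G : FormalMap ι W) :
    bilin B (F - F') G = bilin B F G - bilin B F' G := by
  funext n; simp [bilin_apply, Finset.sum_sub_distrib]

theorem bilin_sub_right (B : V →ₗ[𝕜] W →ₗ[𝕜] X) (F : FormalMap ι V) (G G' : FormalMap ι W) :
    bilin B F (G - G') = bilin B F G - bilin B F G' := by
  funext n; simp [bilin_apply, Finset.sum_sub_distrib]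

theorem bilin_zero_left (B : V →ₗ[𝕜] W →ₗ[𝕜] X) (G : FormalMap ι W) :
    bilin B (0 : FormalMap ι V) G = 0 := by
  funext n; simp [bilin_apply]

theorem bilin_zero_right (B : V →ₗ[𝕜] W →ₗ[𝕜] X) (F : FormalMap ι V) :
    bilin B F (0 : FormalMap ι W) = 0 := by
  funext n; simp [bilin_apply]

theorem bilin_const_left (B : V →ₗ[𝕜] W →ₗ[𝕜] X) (v : V) (G : FormalMap ι W) :
    bilin B (const ι v) G = map (B v) G := by
  funext n
  rw [bilin_apply, sum_antidiagonal_eq_zero_left (fun x y => B (const ι v x) (G y))]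
  · simp [const_apply, map_apply]
  · intro q _ h; simp [const_apply, h]

theorem bilin_flip (B : V →ₗ[𝕜] W →ₗ[𝕜] X) (F : FormalMap ι V) (G : FormalMap ι W) :
    bilin B.flip G F = bilin B F G := by
  funext n
  exact sum_antidiagonal_comm (fun x y => B (F y) (G x)) n

theorem bilin_const_right (B : V →ₗ[𝕜] W →ₗ[𝕜] X) (F : FormalMap ι V) (w : W) :
    bilin B F (const ι w) = map (B.flip w) F := by
  rw [← bilin_flip, bilin_const_left]

/-- Reindexing a triple sum transfers any pointwise associativity relation to formal maps;
`comp_assoc` and `apply_comp` are instances. -/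
theorem bilin_assoc {B : X →ₗ[𝕜] Y →ₗ[𝕜] Z} {C : V →ₗ[𝕜] W →ₗ[𝕜] X}
    {B' : V →ₗ[𝕜] U →ₗ[𝕜] Z} {C' : W →ₗ[𝕜] Y →ₗ[𝕜] U}
    (h : ∀ x y z, B (C x y) z = B' x (C' y z))
    (F : FormalMap ι V) (G : FormalMap ι W) (H : FormalMap ι Y) :
    bilin B (bilin C F G) H = bilin B' F (bilin C' G H) := by
  funext n
  simp only [bilin_apply, map_sum, LinearMap.sum_apply, h]
  exact sum_antidiagonal_assoc (fun x y z => B' (F x) (C' (G y) (H z))) n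

/-- A bilinear operation that is compatible with actions is compatible with the actions on
formal maps. -/
theorem bilin_leibniz {B : V →ₗ[𝕜] W →ₗ[𝕜] X} {D : Y →ₗ[𝕜] X →ₗ[𝕜] X}
    {D₁ : Y →ₗ[𝕜] V →ₗ[𝕜] V} {D₂ : Y →ₗ[𝕜] W →ₗ[𝕜] W}
    (h : ∀ y v w, D y (B v w) = B (D₁ y v) w + B v (D₂ y w))
    (H : FormalMap ι Y) (F : FormalMap ι V) (G : FormalMap ι W) :
    bilin D H (bilin B F G) = bilin B (bilin D₁ H F) G + bilin B F (bilin D₂ H G) := by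
  funext n
  simp only [bilin_apply, map_sum, LinearMap.sum_apply, h, Finset.sum_add_distrib, Pi.add_apply]
  congr 1
  · exact (sum_antidiagonal_assoc (fun x y z => B (D₁ (H x) (F y)) (G z)) n).symm
  · exact sum_antidiagonal_left_comm (fun x y z => B (F y) (D₂ (H x) (G z))) n

theorem map_add_right (f : V →ₗ[𝕜] W) (F F' : FormalMap ι V) :
    map f (F + F') = map f F + map f F' := by
  funext n; simp [map_apply]

theorem map_sub_right (f : V →ₗ[𝕜] W) (F F' : FormalMap ι V) :
    map f (F - F') = map f F - map f F' := by
  funext n; simp [map_apply]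

theorem map_zero_right (f : V →ₗ[𝕜] W) : map f (0 : FormalMap ι V) = 0 := by
  funext n; simp [map_apply]

theorem comp_assoc (F : FormalMap ι (X →ₗ[𝕜] Y)) (G : FormalMap ι (W →ₗ[𝕜] X))
    (H : FormalMap ι (V →ₗ[𝕜] W)) : comp (comp F G) H = comp F (comp G H) :=
  bilin_assoc (fun _ _ _ => rfl) F G H

theorem apply_comp (F : FormalMap ι (W →ₗ[𝕜] X)) (G : FormalMap ι (V →ₗ[𝕜] W))
    (H : FormalMap ι V) : apply (comp F G) H = apply F (apply G H) :=
  bilin_assoc (fun _ _ _ => rfl) F G H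

theorem const_id_comp (F : FormalMap ι (V →ₗ[𝕜] W)) : comp (const ι LinearMap.id) F = F := by
  rw [comp, bilin_const_left]; rfl

theorem comp_const_id (F : FormalMap ι (V →ₗ[𝕜] W)) : comp F (const ι LinearMap.id) = F := by
  rw [comp, bilin_const_right]; rfl

theorem const_id_apply (F : FormalMap ι V) : apply (const ι (LinearMap.id (R := 𝕜))) F = F := by
  rw [apply, bilin_const_left]; rfl

theorem const_comp_apply (f : W →ₗ[𝕜] X) (F : FormalMap ι (V →ₗ[𝕜] W)) (n : ι →₀ ℕ) :
    comp (const ι f) F n = f ∘ₗ F n := by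
  rw [comp, bilin_const_left]; rfl

theorem apply_const (F : FormalMap ι (V →ₗ[𝕜] W)) (v : V) (n : ι →₀ ℕ) :
    apply F (const ι v) n = F n v := by
  rw [apply, bilin_const_right]; rfl

theorem add_comp (F F' : FormalMap ι (W →ₗ[𝕜] X)) (G : FormalMap ι (V →ₗ[𝕜] W)) :
    comp (F + F') G = comp F G + comp F' G := bilin_add_left _ _ _ _

theorem comp_add (F : FormalMap ι (W →ₗ[𝕜] X)) (G G' : FormalMap ι (V →ₗ[𝕜] W)) :
    comp F (G + G') = comp F G + comp F G' := bilin_add_right _ _ _ _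

theorem sub_comp (F F' : FormalMap ι (W →ₗ[𝕜] X)) (G : FormalMap ι (V →ₗ[𝕜] W)) :
    comp (F - F') G = comp F G - comp F' G := bilin_sub_left _ _ _ _

theorem comp_sub (F : FormalMap ι (W →ₗ[𝕜] X)) (G G' : FormalMap ι (V →ₗ[𝕜] W)) :
    comp F (G - G') = comp F G - comp F G' := bilin_sub_right _ _ _ _

theorem zero_comp (G : FormalMap ι (V →ₗ[𝕜] W)) :
    comp (0 : FormalMap ι (W →ₗ[𝕜] X)) G = 0 := bilin_zero_left _ _

theorem comp_zero (F : FormalMap ι (W →ₗ[𝕜] X)) :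
    comp F (0 : FormalMap ι (V →ₗ[𝕜] W)) = 0 := bilin_zero_right _ _

theorem add_apply (F F' : FormalMap ι (V →ₗ[𝕜] W)) (G : FormalMap ι V) :
    apply (F + F') G = apply F G + apply F' G := bilin_add_left _ _ _ _

theorem apply_add (F : FormalMap ι (V →ₗ[𝕜] W)) (G G' : FormalMap ι V) :
    apply F (G + G') = apply F G + apply F G' := bilin_add_right _ _ _ _

theorem zero_apply (G : FormalMap ι V) : apply (0 : FormalMap ι (V →ₗ[𝕜] W)) G = 0 :=
  bilin_zero_left _ _

theorem apply_zero (F : FormalMap ι (V →ₗ[𝕜] W)) : apply F (0 : FormalMap ι V) = 0 :=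
  bilin_zero_right _ _

theorem apply_map (B : V →ₗ[𝕜] W →ₗ[𝕜] X) (F : FormalMap ι V) (G : FormalMap ι W) :
    apply (map B F) G = bilin B F G := rfl

/-- The pointwise transpose of a formal map with values in linear maps. -/
def transpose (F : FormalMap ι (V →ₗ[𝕜] W)) : FormalMap ι (Dual 𝕜 W →ₗ[𝕜] Dual 𝕜 V) :=
  map (Dual.transpose (R := 𝕜)) F

theorem transpose_apply (F : FormalMap ι (V →ₗ[𝕜] W)) (n : ι →₀ ℕ) :
    transpose F n = (F n).dualMap := rfl

theorem transpose_add (F G : FormalMap ι (V →ₗ[𝕜] W)) :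
    transpose (F + G) = transpose F + transpose G := map_add_right _ _ _

theorem transpose_comp (F : FormalMap ι (W →ₗ[𝕜] X)) (G : FormalMap ι (V →ₗ[𝕜] W)) :
    transpose (comp F G) = comp (transpose G) (transpose F) := by
  funext n
  rw [transpose, map_apply, comp_apply, map_sum]
  exact sum_antidiagonal_comm (fun x y => Dual.transpose (R := 𝕜) (F x ∘ₗ G y)) n

theorem transpose_const_id :
    transpose (const ι (LinearMap.id : V →ₗ[𝕜] V)) = const ι LinearMap.id := by
  funext n
  rw [transpose_apply]
  simp only [const_apply]
  split_ifs
  · rfl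
  · ext; simp

/-- If `F` has no constant term, then the coefficient of `B (F, G)` at `n` depends only on the
coefficients of `G` of lower degree. -/
theorem bilin_eq_zero_of_lt {B : V →ₗ[𝕜] W →ₗ[𝕜] X} {F : FormalMap ι V} {G : FormalMap ι W}
    (hF : F 0 = 0) {n : ι →₀ ℕ} (hG : ∀ k : ι →₀ ℕ, k.degree < n.degree → G k = 0) :
    bilin B F G n = 0 := by
  rw [bilin_apply]
  refine Finset.sum_eq_zero fun q hq => ?_
  by_cases h : q.1 = 0
  · simp [h, hF]
  · have h1 := degree_add_degree hq
    have h2 : q.1.degree ≠ 0 := by simpa [Finsupp.degree_eq_zero_iff] using h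
    rw [hG q.2 (by omega), LinearMap.map_zero]

section Pderiv

theorem pderiv_apply (i : ι) (F : FormalMap ι V) (n : ι →₀ ℕ) :
    pderiv 𝕜 i F n = ((n i : 𝕜) + 1) • F (n + Finsupp.single i 1) := rfl

theorem pderiv_bilin (i : ι) (B : V →ₗ[𝕜] W →ₗ[𝕜] X) (F : FormalMap ι V) (G : FormalMap ι W) :
    pderiv 𝕜 i (bilin B F G) = bilin B (pderiv 𝕜 i F) G + bilin B F (pderiv 𝕜 i G) := by
  funext n
  have h1 := sum_antidiagonal_single_smul (𝕜 := 𝕜) i (fun x y => B (F x) (G y)) n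
  have h2 := sum_antidiagonal_single_smul (𝕜 := 𝕜) i (fun x y => B (F y) (G x)) n
  rw [sum_antidiagonal_comm (fun x y => (x i : 𝕜) • B (F y) (G x)),
    sum_antidiagonal_comm (fun x y => ((x i : 𝕜) + 1) • B (F y) (G (x + Finsupp.single i 1)))]
    at h2
  simp only [Pi.add_apply, pderiv_apply, bilin_apply, map_smul, LinearMap.smul_apply]
  rw [← h1, ← h2, ← Finset.sum_add_distrib, Finset.smul_sum]
  refine Finset.sum_congr rfl fun q hq => ?_
  -- The weights `q.1 i` and `q.2 i` add up to `n i + 1` on this antidiagonal.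
  rw [← add_smul, ← Nat.cast_add, ← Finsupp.add_apply, mem_antidiagonal.1 hq]
  simp

end Pderiv

end Basic

/-! ### Differential calculus on the formal neighbourhood of 0 in a dual space. -/

section Dual

open Finset.HasAntidiagonal (antidiagonal mem_antidiagonal)

variable {𝕜 : Type*} [Field 𝕜] {ι : Type*} [Fintype ι] [DecidableEq ι]
  {E V W X : Type*} [AddCommGroup E] [Module 𝕜 E] [AddCommGroup V] [Module 𝕜 V]
  [AddCommGroup W] [Module 𝕜 W] [AddCommGroup X] [Module 𝕜 X] (b : Basis ι 𝕜 E)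

theorem dirDeriv_eq_sum (F : FormalMap ι V) (α : Dual 𝕜 E) (n : ι →₀ ℕ) :
    dirDeriv b F α n = ∑ i, α (b i) • pderiv 𝕜 i F n := by
  simp [dirDeriv, differential]

theorem differential_apply (F : FormalMap ι V) (α : Dual 𝕜 E) (n : ι →₀ ℕ) :
    differential b F n α = dirDeriv b F α n := rfl

theorem dirDeriv_bilin (B : V →ₗ[𝕜] W →ₗ[𝕜] X) (F : FormalMap ι V) (G : FormalMap ι W)
    (α : Dual 𝕜 E) :
    dirDeriv b (bilin B F G) α = bilin B (dirDeriv b F α) G + bilin B F (dirDeriv b G α) := by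
  funext n
  simp only [dirDeriv_eq_sum, pderiv_bilin, Pi.add_apply, bilin_apply, smul_add, Finset.smul_sum,
    map_sum, map_smul, LinearMap.sum_apply, LinearMap.smul_apply, Finset.sum_add_distrib]
  congr 1 <;> exact Finset.sum_comm

theorem differential_map (f : V →ₗ[𝕜] W) (F : FormalMap ι V) :
    differential b (map f F) = map (LinearMap.llcomp 𝕜 (Dual 𝕜 E) V W f) (differential b F) := by
  funext n
  ext α
  simp [differential_apply, map_apply, dirDeriv_eq_sum, pderiv_apply]

theorem dirDeriv_map (f : V →ₗ[𝕜] W) (F : FormalMap ι V) (α : Dual 𝕜 E) (n : ι →₀ ℕ) :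
    dirDeriv b (map f F) α n = f (dirDeriv b F α n) := by
  rw [← differential_apply, differential_map]; rfl

theorem differential_add (F G : FormalMap ι V) :
    differential b (F + G) = differential b F + differential b G := by
  funext n
  ext α
  simp [differential_apply, dirDeriv_eq_sum, pderiv_apply, Finset.sum_add_distrib]

theorem differential_sub (F G : FormalMap ι V) :
    differential b (F - G) = differential b F - differential b G := by
  funext n
  ext α
  simp [differential_apply, dirDeriv_eq_sum, pderiv_apply, Finset.sum_sub_distrib, smul_sub]

theorem differential_zero : differential b (0 : FormalMap ι V) = 0 := by
  funext n
  ext α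
  simp [differential_apply, dirDeriv_eq_sum, pderiv_apply]

theorem dirDeriv_add (F G : FormalMap ι V) (α : Dual 𝕜 E) :
    dirDeriv b (F + G) α = dirDeriv b F α + dirDeriv b G α := by
  funext n
  simp only [dirDeriv, differential_add]; rfl

theorem dirDeriv_sub (F G : FormalMap ι V) (α : Dual 𝕜 E) :
    dirDeriv b (F - G) α = dirDeriv b F α - dirDeriv b G α := by
  funext n
  simp only [dirDeriv, differential_sub]; rfl

/-- `differential` depends only on the coefficients one degree higher. -/
theorem differential_congr {F G : FormalMap ι V} {n : ι →₀ ℕ}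
    (h : ∀ k : ι →₀ ℕ, k.degree = n.degree + 1 → F k = G k) :
    differential b F n = differential b G n := by
  unfold differential pderiv
  refine Finset.sum_congr rfl fun i _ => ?_
  rw [h]
  simp

/-- The derivative of a formal map along a formal vector field. -/
def fieldDeriv (P : FormalMap ι (Dual 𝕜 E)) (F : FormalMap ι V) : FormalMap ι V :=
  apply (differential b F) P

theorem fieldDeriv_apply (P : FormalMap ι (Dual 𝕜 E)) (F : FormalMap ι V) (n : ι →₀ ℕ) :
    fieldDeriv b P F n = ∑ q ∈ antidiagonal n, dirDeriv b F (P q.2) q.1 := rfl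

theorem fieldDeriv_bilin (P : FormalMap ι (Dual 𝕜 E)) (B : V →ₗ[𝕜] W →ₗ[𝕜] X)
    (F : FormalMap ι V) (G : FormalMap ι W) :
    fieldDeriv b P (bilin B F G)
      = bilin B (fieldDeriv b P F) G + bilin B F (fieldDeriv b P G) := by
  funext n
  simp only [Pi.add_apply, bilin_apply, fieldDeriv_apply, dirDeriv_bilin, map_sum,
    LinearMap.sum_apply, Finset.sum_add_distrib]
  congr 1
  · exact sum_antidiagonal_right_comm (fun x y z => B (dirDeriv b F (P z) x) (G y)) n
  · exact sum_antidiagonal_assoc (fun x y z => B (F x) (dirDeriv b G (P z) y)) n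

theorem fieldDeriv_map (P : FormalMap ι (Dual 𝕜 E)) (f : V →ₗ[𝕜] W) (F : FormalMap ι V) :
    fieldDeriv b P (map f F) = map f (fieldDeriv b P F) := by
  funext n
  simp [fieldDeriv_apply, map_apply, dirDeriv_map]

theorem fieldDeriv_add (P : FormalMap ι (Dual 𝕜 E)) (F G : FormalMap ι V) :
    fieldDeriv b P (F + G) = fieldDeriv b P F + fieldDeriv b P G := by
  rw [fieldDeriv, differential_add, apply, bilin_add_left]; rfl

theorem fieldDeriv_sub (P : FormalMap ι (Dual 𝕜 E)) (F G : FormalMap ι V) :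
    fieldDeriv b P (F - G) = fieldDeriv b P F - fieldDeriv b P G := by
  rw [fieldDeriv, differential_sub, apply, bilin_sub_left]; rfl

theorem point_eq_zero {n : ι →₀ ℕ} (hn : n.degree ≠ 1) : point b n = 0 := by
  refine Finset.sum_eq_zero fun i _ => if_neg ?_
  rintro rfl
  simp at hn

theorem pderiv_point (i : ι) : pderiv 𝕜 i (point b) = const ι (b.coord i) := by
  funext n
  rw [pderiv_apply, const_apply, point]
  split_ifs with h
  · subst h
    simp [Finsupp.single_left_inj]
  · rw [Finset.sum_eq_zero, smul_zero]
    intro j _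
    refine if_neg fun hj => h ?_
    have h1 := congrArg Finsupp.degree hj
    simp only [map_add, Finsupp.degree_single] at h1
    exact (Finsupp.degree_eq_zero_iff n).1 (by omega)

theorem dirDeriv_point (α : Dual 𝕜 E) : dirDeriv b (point b) α = const ι α := by
  funext n
  simp only [dirDeriv_eq_sum, pderiv_point, const_apply]
  split_ifs
  · refine b.ext fun j => ?_
    simp
  · simp

/-- Euler's identity. -/
theorem fieldDeriv_point (F : FormalMap ι V) (n : ι →₀ ℕ) :
    fieldDeriv b (point b) F n = (n.degree : 𝕜) • F n := by
  rw [fieldDeriv_apply]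
  have h : ∀ q : (ι →₀ ℕ) × (ι →₀ ℕ), dirDeriv b F (point b q.2) q.1
      = ∑ i, if q.2 = Finsupp.single i 1 then pderiv 𝕜 i F q.1 else 0 := by
    intro q
    simp only [dirDeriv_eq_sum]
    refine Finset.sum_congr rfl fun i _ => ?_
    simp only [point, LinearMap.sum_apply]
    rw [Finset.sum_eq_single i]
    · split_ifs <;> simp
    · intro j _ hj
      split_ifs <;> simp [hj.symm]
    · simp
  simp only [h]
  rw [Finset.sum_comm, Finsupp.degree_eq_sum, Nat.cast_sum, Finset.sum_smul]
  refine Finset.sum_congr rfl fun i _ => ?_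
  by_cases hi : n i = 0
  · rw [hi, Nat.cast_zero, zero_smul]
    refine Finset.sum_eq_zero fun q hq => if_neg fun h => ?_
    have := mem_antidiagonal.1 hq
    rw [h] at this
    rw [← this] at hi
    simp at hi
  · have hle : Finsupp.single i 1 ≤ n := by
      rw [Finsupp.single_le_iff]; omega
    rw [Finset.sum_eq_single (n - Finsupp.single i 1, Finsupp.single i 1)]
    · simp only [if_true, pderiv_apply, tsub_add_cancel_of_le hle]
      congr 1
      have : n i = (n - Finsupp.single i 1 : ι →₀ ℕ) i + 1 := by
        simp; omega
      rw [this]; push_cast; rfl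
    · rintro ⟨a, c⟩ hq hne
      refine if_neg fun h => hne ?_
      simp only at h
      subst h
      simp [← mem_antidiagonal.1 hq]
    · intro h
      exact absurd (mem_antidiagonal.2 (tsub_add_cancel_of_le hle)) h

end Dual

end FormalMap

namespace FormalMap

/-! ### Power series in an endomorphism without constant term. -/

section Series

open Finset.HasAntidiagonal (antidiagonal mem_antidiagonal)

variable {𝕜 : Type*} [Field 𝕜] {ι : Type*} [DecidableEq ι]
  {V W X : Type*} [AddCommGroup V] [Module 𝕜 V] [AddCommGroup W] [Module 𝕜 W]
  [AddCommGroup X] [Module 𝕜 X]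

/-- Each factor `T` raises the degree by at least one. Hence the truncation in `series` loses
nothing and its range may be enlarged at will. -/
theorem pow_eq_zero {T : FormalMap ι (V →ₗ[𝕜] V)} (hT : T 0 = 0) {k : ℕ} {n : ι →₀ ℕ}
    (h : n.degree < k) : pow T k n = 0 := by
  induction k generalizing n with
  | zero => omega
  | succ k ih => exact bilin_eq_zero_of_lt hT fun j hj => ih (by omega)

theorem pow_succ_right (T : FormalMap ι (V →ₗ[𝕜] V)) (k : ℕ) :
    pow T (k + 1) = comp (pow T k) T := by
  induction k with
  | zero => change comp T (const ι _) = comp (const ι _) T; rw [comp_const_id, const_id_comp]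
  | succ k ih =>
    change comp T (pow T (k + 1)) = comp (comp T (pow T k)) T
    rw [ih, comp_assoc]

theorem pow_congr {T T' : FormalMap ι (V →ₗ[𝕜] V)} {N : ℕ}
    (h : ∀ n : ι →₀ ℕ, n.degree ≤ N → T n = T' n) (k : ℕ) {n : ι →₀ ℕ} (hn : n.degree ≤ N) :
    pow T k n = pow T' k n := by
  induction k generalizing n with
  | zero => rfl
  | succ k ih =>
    refine Finset.sum_congr rfl fun q hq => ?_
    have := degree_add_degree hq
    rw [h q.1 (by omega), ih (n := q.2) (by omega)]

theorem series_congr (c : ℕ → 𝕜) {T T' : FormalMap ι (V →ₗ[𝕜] V)} {N : ℕ}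
    (h : ∀ n : ι →₀ ℕ, n.degree ≤ N → T n = T' n) {n : ι →₀ ℕ} (hn : n.degree ≤ N) :
    series c T n = series c T' n := by
  refine Finset.sum_congr rfl fun k _ => ?_
  rw [pow_congr h k hn]

theorem series_apply_of_lt (c : ℕ → 𝕜) {T : FormalMap ι (V →ₗ[𝕜] V)} (hT : T 0 = 0) {N : ℕ}
    {n : ι →₀ ℕ} (h : n.degree < N) :
    series c T n = ∑ k ∈ Finset.range N, c k • pow T k n := by
  refine Finset.sum_subset (fun k hk => ?_) fun k _ hk => ?_
  · simp only [Finset.mem_range] at hk ⊢; omega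
  · rw [pow_eq_zero hT, smul_zero]
    simp only [Finset.mem_range] at hk; omega

theorem comp_series_apply (c : ℕ → 𝕜) {T : FormalMap ι (V →ₗ[𝕜] V)} (hT : T 0 = 0)
    (n : ι →₀ ℕ) :
    comp T (series c T) n = ∑ k ∈ Finset.range (n.degree + 1), c k • pow T (k + 1) n := by
  have h : ∀ q ∈ antidiagonal n, T q.1 ∘ₗ series c T q.2
      = ∑ k ∈ Finset.range (n.degree + 1), c k • (T q.1 ∘ₗ pow T k q.2) := by
    intro q hq
    have := degree_add_degree hq
    rw [series_apply_of_lt c hT (N := n.degree + 1) (by omega)]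
    ext v
    simp [LinearMap.sum_apply]
  rw [comp_apply, Finset.sum_congr rfl h, Finset.sum_comm]
  simp only [← Finset.smul_sum]
  rfl

theorem series_comp_apply (c : ℕ → 𝕜) {T : FormalMap ι (V →ₗ[𝕜] V)} (hT : T 0 = 0)
    (n : ι →₀ ℕ) :
    comp (series c T) T n = ∑ k ∈ Finset.range (n.degree + 1), c k • pow T (k + 1) n := by
  have h : ∀ q ∈ antidiagonal n, series c T q.1 ∘ₗ T q.2
      = ∑ k ∈ Finset.range (n.degree + 1), c k • (pow T k q.1 ∘ₗ T q.2) := by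
    intro q hq
    have := degree_add_degree hq
    rw [series_apply_of_lt c hT (N := n.degree + 1) (by omega)]
    ext v
    simp [LinearMap.sum_apply]
  rw [comp_apply, Finset.sum_congr rfl h, Finset.sum_comm]
  simp only [← Finset.smul_sum, pow_succ_right]
  rfl

theorem comp_series_comm (c : ℕ → 𝕜) {T : FormalMap ι (V →ₗ[𝕜] V)} (hT : T 0 = 0) :
    comp T (series c T) = comp (series c T) T := by
  funext n
  rw [comp_series_apply c hT, series_comp_apply c hT]

theorem series_eq_add (c : ℕ → 𝕜) {T : FormalMap ι (V →ₗ[𝕜] V)} (hT : T 0 = 0) :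
    series c T = const ι (c 0 • LinearMap.id) + comp T (series (fun k => c (k + 1)) T) := by
  funext n
  rw [Pi.add_apply, comp_series_apply _ hT, series_apply_of_lt c hT (N := n.degree + 1 + 1)
    (by omega), Finset.sum_range_succ', add_comm]
  congr 1
  change c 0 • const ι _ n = _
  simp only [const_apply]
  split_ifs <;> simp

theorem series_apply_zero (c : ℕ → 𝕜) (T : FormalMap ι (V →ₗ[𝕜] V)) :
    series c T 0 = c 0 • LinearMap.id := by
  simp [series, pow, const_apply]

/-- `e ^ (t T)`. -/
def flow (T : FormalMap ι (V →ₗ[𝕜] V)) (t : 𝕜) : FormalMap ι (V →ₗ[𝕜] V) :=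
  series (fun k => (k.factorial : 𝕜)⁻¹ * t ^ k) T

/-- `(e ^ (t T) - 1) / T`. -/
def flowIntegral (T : FormalMap ι (V →ₗ[𝕜] V)) (t : 𝕜) : FormalMap ι (V →ₗ[𝕜] V) :=
  series (fun k => ((k + 1).factorial : 𝕜)⁻¹ * t ^ (k + 1)) T

theorem flow_one (T : FormalMap ι (V →ₗ[𝕜] V)) : flow T 1 = exp T := by
  simp [flow, exp]

theorem flowIntegral_one (T : FormalMap ι (V →ₗ[𝕜] V)) : flowIntegral T 1 = expDiv T := by
  simp [flowIntegral, expDiv]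

theorem flow_eq_add {T : FormalMap ι (V →ₗ[𝕜] V)} (hT : T 0 = 0) (t : 𝕜) :
    flow T t = const ι LinearMap.id + comp T (flowIntegral T t) := by
  rw [flow, series_eq_add _ hT]
  simp [flowIntegral]

theorem exp_eq_add {T : FormalMap ι (V →ₗ[𝕜] V)} (hT : T 0 = 0) :
    exp T = const ι LinearMap.id + comp T (expDiv T) := by
  rw [← flow_one, flow_eq_add hT, flowIntegral_one]

theorem expDiv_comm {T : FormalMap ι (V →ₗ[𝕜] V)} (hT : T 0 = 0) :
    comp T (expDiv T) = comp (expDiv T) T :=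
  comp_series_comm _ hT

theorem series_zero_of_ne (c : ℕ → 𝕜) (hc : ∀ k, k ≠ 0 → c k = 0) (T : FormalMap ι (V →ₗ[𝕜] V)) :
    series c T = const ι (c 0 • LinearMap.id) := by
  funext n
  rw [series, Finset.sum_eq_single 0]
  · change c 0 • const ι _ n = _
    simp only [const_apply]
    split_ifs <;> simp
  · intro k _ hk; rw [hc k hk, zero_smul]
  · simp

theorem flow_zero (T : FormalMap ι (V →ₗ[𝕜] V)) : flow T 0 = const ι LinearMap.id := by
  rw [flow, series_zero_of_ne _ (by intro k hk; simp [hk])]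
  simp

theorem flowIntegral_zero (T : FormalMap ι (V →ₗ[𝕜] V)) : flowIntegral T 0 = 0 := by
  rw [flowIntegral, series_zero_of_ne _ (by intro k hk; simp)]
  funext n
  simp [const_apply]

theorem expDiv_apply_zero (T : FormalMap ι (V →ₗ[𝕜] V)) : expDiv T 0 = LinearMap.id := by
  rw [expDiv, series_apply_zero]; simp

end Series

end FormalMap

/-! ### Derivatives of paths in vector spaces without a topology. -/

section WeakDerivative

variable {𝕜 : Type*} [RCLike 𝕜] {V W X : Type*} [AddCommGroup V] [Module 𝕜 V] [AddCommGroup W]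
  [Module 𝕜 W] [AddCommGroup X] [Module 𝕜 X]

/-- The derivative of a path in a vector space, tested against all linear forms. -/
def HasWeakDerivAt (f : 𝕜 → V) (f' : V) (t : 𝕜) : Prop :=
  ∀ L : Dual 𝕜 V, HasDerivAt (fun s => L (f s)) (L f') t

namespace HasWeakDerivAt

theorem const (v : V) (t : 𝕜) : HasWeakDerivAt (fun _ : 𝕜 => v) 0 t := by
  intro L
  simpa using hasDerivAt_const t (L v)

theorem add {f g : 𝕜 → V} {f' g' : V} {t : 𝕜} (hf : HasWeakDerivAt f f' t)
    (hg : HasWeakDerivAt g g' t) : HasWeakDerivAt (fun s => f s + g s) (f' + g') t := by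
  intro L
  simpa using (hf L).fun_add (hg L)

theorem sub {f g : 𝕜 → V} {f' g' : V} {t : 𝕜} (hf : HasWeakDerivAt f f' t)
    (hg : HasWeakDerivAt g g' t) : HasWeakDerivAt (fun s => f s - g s) (f' - g') t := by
  intro L
  simpa using (hf L).fun_sub (hg L)

theorem sum {κ : Type*} {s : Finset κ} {f : κ → 𝕜 → V} {f' : κ → V} {t : 𝕜}
    (h : ∀ i ∈ s, HasWeakDerivAt (f i) (f' i) t) :
    HasWeakDerivAt (fun u => ∑ i ∈ s, f i u) (∑ i ∈ s, f' i) t := by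
  intro L
  simpa using HasDerivAt.fun_sum fun i hi => h i hi L

theorem map {f : 𝕜 → V} {f' : V} {t : 𝕜} (A : V →ₗ[𝕜] W) (hf : HasWeakDerivAt f f' t) :
    HasWeakDerivAt (fun s => A (f s)) (A f') t :=
  fun L => hf (L ∘ₗ A)

theorem smul {c : 𝕜 → 𝕜} {c' t : 𝕜} (hc : HasDerivAt c c' t) (v : V) :
    HasWeakDerivAt (fun s => c s • v) (c' • v) t := by
  intro L
  simpa using hc.mul_const (L v)

/-- Expanding the first argument in a finite basis reduces the claim to the product rule for scalar
functions. -/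
theorem bilin [FiniteDimensional 𝕜 V] (B : V →ₗ[𝕜] W →ₗ[𝕜] X) {f : 𝕜 → V} {g : 𝕜 → W}
    {f' : V} {g' : W} {t : 𝕜} (hf : HasWeakDerivAt f f' t) (hg : HasWeakDerivAt g g' t) :
    HasWeakDerivAt (fun s => B (f s) (g s)) (B f' (g t) + B (f t) g') t := by
  intro L
  let e := Module.finBasis 𝕜 V
  have key : ∀ v w, L (B v w) = ∑ i, e.coord i v * L (B (e i) w) := by
    intro v w
    conv_lhs => rw [← e.sum_repr v]
    simp only [map_sum, map_smul, LinearMap.sum_apply, LinearMap.smul_apply, smul_eq_mul,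
      Basis.coord_apply]
  rw [map_add, key, key, ← Finset.sum_add_distrib]
  simp only [fun s => key (f s) (g s)]
  exact HasDerivAt.fun_sum fun i _ => (hf (e.coord i)).fun_mul (hg (L ∘ₗ B (e i)))

theorem congr_deriv {f : 𝕜 → V} {f' f'' : V} {t : 𝕜} (hf : HasWeakDerivAt f f' t)
    (h : f' = f'') : HasWeakDerivAt f f'' t := h ▸ hf

/-- Linear forms separate points, so the mean value theorem for scalar functions on 𝕜 suffices. -/
theorem eq_const {f : 𝕜 → V} (h : ∀ t, HasWeakDerivAt f 0 t) (t : 𝕜) : f t = f 0 := by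
  rw [← sub_eq_zero, ← Module.forall_dual_apply_eq_zero_iff 𝕜]
  intro L
  rw [map_sub, sub_eq_zero]
  refine is_const_of_deriv_eq_zero (𝕜 := 𝕜) (f := fun s => L (f s))
    (fun s => (h s L).differentiableAt) (fun s => ?_) t 0
  simpa using (h s L).deriv

end HasWeakDerivAt

end WeakDerivative

namespace FormalMap

/-! ### Differential equations for formal maps. -/

section WeakDerivative

open Finset.HasAntidiagonal (antidiagonal mem_antidiagonal)

variable {𝕜 : Type*} [RCLike 𝕜] {ι : Type*} [DecidableEq ι]
  {V W X : Type*} [AddCommGroup V] [Module 𝕜 V] [AddCommGroup W]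
  [Module 𝕜 W] [AddCommGroup X] [Module 𝕜 X]

theorem hasWeakDerivAt_bilin [FiniteDimensional 𝕜 V] (B : V →ₗ[𝕜] W →ₗ[𝕜] X)
    {F : 𝕜 → FormalMap ι V} {G : 𝕜 → FormalMap ι W} {F' : FormalMap ι V} {G' : FormalMap ι W}
    {t : 𝕜} (hF : ∀ n, HasWeakDerivAt (fun s => F s n) (F' n) t)
    (hG : ∀ n, HasWeakDerivAt (fun s => G s n) (G' n) t) (n : ι →₀ ℕ) :
    HasWeakDerivAt (fun s => bilin B (F s) (G s) n) ((bilin B F' (G t) + bilin B (F t) G') n) t := by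
  refine (HasWeakDerivAt.sum fun q _ => (hF q.1).bilin B (hG q.2)).congr_deriv ?_
  rw [Finset.sum_add_distrib]; rfl

theorem hasWeakDerivAt_comp [FiniteDimensional 𝕜 W] [FiniteDimensional 𝕜 X]
    {F : 𝕜 → FormalMap ι (W →ₗ[𝕜] X)} {G : 𝕜 → FormalMap ι (V →ₗ[𝕜] W)}
    {F' : FormalMap ι (W →ₗ[𝕜] X)} {G' : FormalMap ι (V →ₗ[𝕜] W)}
    {t : 𝕜} (hF : ∀ n, HasWeakDerivAt (fun s => F s n) (F' n) t)
    (hG : ∀ n, HasWeakDerivAt (fun s => G s n) (G' n) t) (n : ι →₀ ℕ) :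
    HasWeakDerivAt (fun s => comp (F s) (G s) n) ((comp F' (G t) + comp (F t) G') n) t :=
  hasWeakDerivAt_bilin _ hF hG n

theorem hasWeakDerivAt_apply [FiniteDimensional 𝕜 V] [FiniteDimensional 𝕜 W]
    {F : 𝕜 → FormalMap ι (V →ₗ[𝕜] W)} {G : 𝕜 → FormalMap ι V}
    {F' : FormalMap ι (V →ₗ[𝕜] W)} {G' : FormalMap ι V}
    {t : 𝕜} (hF : ∀ n, HasWeakDerivAt (fun s => F s n) (F' n) t)
    (hG : ∀ n, HasWeakDerivAt (fun s => G s n) (G' n) t) (n : ι →₀ ℕ) :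
    HasWeakDerivAt (fun s => apply (F s) (G s) n) ((apply F' (G t) + apply (F t) G') n) t :=
  hasWeakDerivAt_bilin _ hF hG n

theorem hasWeakDerivAt_transpose {F : 𝕜 → FormalMap ι (V →ₗ[𝕜] W)}
    {F' : FormalMap ι (V →ₗ[𝕜] W)} {t : 𝕜}
    (hF : ∀ n, HasWeakDerivAt (fun s => F s n) (F' n) t) (n : ι →₀ ℕ) :
    HasWeakDerivAt (fun s => transpose (F s) n) (transpose F' n) t :=
  fun L => hF n (L ∘ₗ (Dual.transpose (R := 𝕜) : (V →ₗ[𝕜] W) →ₗ[𝕜] _))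

theorem hasWeakDerivAt_flow {T : FormalMap ι (V →ₗ[𝕜] V)} (hT : T 0 = 0) (t : 𝕜) (n : ι →₀ ℕ) :
    HasWeakDerivAt (fun s => flow T s n) (comp T (flow T t) n) t := by
  -- One extra term, zero by degree, is included. Differentiation kills the term k = 0, and after
  -- the index shift the range is the one in `comp_series_apply`.
  have h : ∀ s, flow T s n = ∑ k ∈ Finset.range (n.degree + 1 + 1),
      ((k.factorial : 𝕜)⁻¹ * s ^ k) • pow T k n := fun s =>
    series_apply_of_lt _ hT (by omega)
  simp only [h]
  refine (HasWeakDerivAt.sum (f' := fun k : ℕ => ((k.factorial : 𝕜)⁻¹ * ((k : 𝕜) * t ^ (k - 1)))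
    • pow T k n) fun k _ => HasWeakDerivAt.smul ((hasDerivAt_pow k t).const_mul _) _).congr_deriv ?_
  rw [Finset.sum_range_succ', flow, comp_series_apply _ hT]
  simp only [Nat.cast_zero, zero_mul, mul_zero, zero_smul, add_zero]
  refine Finset.sum_congr rfl fun k _ => ?_
  congr 1
  rw [Nat.factorial_succ]
  have : ((k : 𝕜) + 1) ≠ 0 := by exact_mod_cast Nat.succ_ne_zero k
  push_cast
  field_simp

theorem hasWeakDerivAt_flowIntegral (T : FormalMap ι (V →ₗ[𝕜] V)) (t : 𝕜) (n : ι →₀ ℕ) :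
    HasWeakDerivAt (fun s => flowIntegral T s n) (flow T t n) t := by
  change HasWeakDerivAt (fun s => ∑ k ∈ Finset.range (n.degree + 1),
    (((k + 1).factorial : 𝕜)⁻¹ * s ^ (k + 1)) • pow T k n) _ t
  refine (HasWeakDerivAt.sum (f' := fun k : ℕ => (((k + 1).factorial : 𝕜)⁻¹
    * (((k + 1 : ℕ) : 𝕜) * t ^ (k + 1 - 1))) • pow T k n) fun k _ =>
      HasWeakDerivAt.smul ((hasDerivAt_pow (k + 1) t).const_mul _) _).congr_deriv ?_
  refine Finset.sum_congr rfl fun k _ => ?_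
  congr 1
  rw [Nat.factorial_succ]
  have : ((k : 𝕜) + 1) ≠ 0 := by exact_mod_cast Nat.succ_ne_zero k
  push_cast
  field_simp

/-- Uniqueness for the linear differential equation `F' = B (H, F)` where `H` has no constant
term. -/
theorem eq_zero_of_hasWeakDerivAt {B : W →ₗ[𝕜] V →ₗ[𝕜] V} {H : FormalMap ι W} (hH : H 0 = 0)
    {F : 𝕜 → FormalMap ι V} (h0 : F 0 = 0)
    (h : ∀ t n, HasWeakDerivAt (fun s => F s n) (bilin B H (F t) n) t) (t : 𝕜) : F t = 0 := by
  have key : ∀ N : ℕ, ∀ n : ι →₀ ℕ, n.degree = N → ∀ t, F t n = 0 := by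
    intro N
    induction N using Nat.strong_induction_on with
    | _ N ih =>
      intro n hn t
      -- The derivative of the coefficient at `n` involves only coefficients of lower degree, which
      -- vanish by induction, so the coefficient keeps its initial value 0.
      rw [HasWeakDerivAt.eq_const (f := fun s => F s n) (fun s => ?_) t, h0]
      · rfl
      · refine (h s n).congr_deriv (bilin_eq_zero_of_lt hH fun k hk => ?_)
        exact ih _ (hn ▸ hk) k rfl s
  funext n
  exact key _ n rfl t

end WeakDerivative

end FormalMap

open FormalMap

/-! ### The action on maps g* → g and skew-symmetrisation. -/

section Pointwise

variable {𝕜 : Type*} [Field 𝕜] {g : Type*} [LieRing g] [LieAlgebra 𝕜 g]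

theorem adStar_apply (x : g) (ξ : Dual 𝕜 g) (y : g) : adStar 𝕜 x ξ y = ξ ⁅x, y⁆ := rfl

theorem adjAction_apply (x : g) (t : Dual 𝕜 g →ₗ[𝕜] g) (ξ : Dual 𝕜 g) :
    adjAction 𝕜 g x t ξ = ⁅x, t ξ⁆ + t (adStar 𝕜 x ξ) := rfl

theorem adjAction_lie (x y : g) (t : Dual 𝕜 g →ₗ[𝕜] g) :
    adjAction 𝕜 g x (adjAction 𝕜 g y t)
      = adjAction 𝕜 g ⁅x, y⁆ t + adjAction 𝕜 g y (adjAction 𝕜 g x t) := by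
  ext ξ
  have h : adStar 𝕜 ⁅x, y⁆ ξ = adStar 𝕜 y (adStar 𝕜 x ξ) - adStar 𝕜 x (adStar 𝕜 y ξ) := by
    ext v
    simp only [LinearMap.sub_apply, adStar_apply, lie_lie, map_sub]
  simp only [LinearMap.add_apply, adjAction_apply, h, map_sub, lie_add, lie_lie]
  abel

variable [FiniteDimensional 𝕜 g] {l : LieSubalgebra 𝕜 g}

theorem restrictDual_apply (ξ : Dual 𝕜 g) (z : l) : restrictDual l ξ z = ξ z := rfl

/-- The adjoint `A* : g* → l** = l` of a linear map `A : l* → g`. -/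
def dualVec (A : Dual 𝕜 l →ₗ[𝕜] g) (ξ : Dual 𝕜 g) : l :=
  (evalEquiv 𝕜 l).symm (A.dualMap ξ)

theorem dual_dualVec (A : Dual 𝕜 l →ₗ[𝕜] g) (ξ : Dual 𝕜 g) (α : Dual 𝕜 l) :
    α (dualVec A ξ) = ξ (A α) := by
  simp [dualVec]

theorem inclAdjoint_apply (A : Dual 𝕜 l →ₗ[𝕜] g) (ξ : Dual 𝕜 g) :
    inclAdjoint l A ξ = dualVec A ξ := rfl

theorem dual_inclAdjoint (A : Dual 𝕜 l →ₗ[𝕜] g) (ξ η : Dual 𝕜 g) :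
    η (inclAdjoint l A ξ) = ξ (A (restrictDual l η)) := by
  rw [inclAdjoint_apply, ← restrictDual_apply, dual_dualVec]

theorem inclAdjoint_comp (f : g →ₗ[𝕜] g) (A : Dual 𝕜 l →ₗ[𝕜] g) :
    inclAdjoint l (f ∘ₗ A) = inclAdjoint l A ∘ₗ f.dualMap := by
  ext ξ
  rw [← sub_eq_zero, ← Module.forall_dual_apply_eq_zero_iff 𝕜]
  intro η
  rw [map_sub, LinearMap.comp_apply, dual_inclAdjoint, dual_inclAdjoint]
  simp

variable (l) in
/-- The skew-symmetrisation `A ↦ A i* - i A*`. -/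
def skewPart : (Dual 𝕜 l →ₗ[𝕜] g) →ₗ[𝕜] (Dual 𝕜 g →ₗ[𝕜] g) :=
  LinearMap.lcomp 𝕜 g (restrictDual l) - inclAdjoint l

theorem skewPart_apply (A : Dual 𝕜 l →ₗ[𝕜] g) (ξ : Dual 𝕜 g) :
    skewPart l A ξ = A (restrictDual l ξ) - inclAdjoint l A ξ := rfl

theorem dual_skewPart (A : Dual 𝕜 l →ₗ[𝕜] g) (ξ η : Dual 𝕜 g) :
    η (skewPart l A ξ) = η (A (restrictDual l ξ)) - ξ (A (restrictDual l η)) := by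
  rw [skewPart_apply, map_sub, dual_inclAdjoint]

theorem isSkew_skewPart (A : Dual 𝕜 l →ₗ[𝕜] g) : IsSkew (skewPart l A) := by
  intro ξ η
  rw [dual_skewPart, dual_skewPart]; ring

theorem IsSkew.adjAction {t : Dual 𝕜 g →ₗ[𝕜] g} (ht : IsSkew t) (x : g) :
    IsSkew (adjAction 𝕜 g x t) := by
  intro ξ η
  simp only [adjAction_apply, map_add]
  rw [← adStar_apply, ← adStar_apply, ht, ht ξ (adStar 𝕜 x η)]; ring

end Pointwise

/-! ### Equivariant logarithms. -/

section Formal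

open Finset.HasAntidiagonal (antidiagonal mem_antidiagonal)

variable {𝕜 : Type*} [Field 𝕜] {g : Type*} [LieRing g] [LieAlgebra 𝕜 g]
  [FiniteDimensional 𝕜 g] {l : LieSubalgebra 𝕜 g} {ι : Type*} [Fintype ι] [DecidableEq ι]
  (b : Basis ι 𝕜 l)

/-- `p ↦ ad_{S p}`. -/
def formalAdjoint (S : FormalMap ι g) : FormalMap ι (g →ₗ[𝕜] g) :=
  map (LieAlgebra.ad 𝕜 g : g →ₗ[𝕜] g →ₗ[𝕜] g) S

theorem formalAdjoint_zero {S : FormalMap ι g} (hS : S 0 = 0) :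
    formalAdjoint (𝕜 := 𝕜) S 0 = 0 := by
  rw [formalAdjoint, map_apply, hS, map_zero]

theorem bilin_adjAction (S : FormalMap ι g) (F : FormalMap ι (Dual 𝕜 g →ₗ[𝕜] g)) :
    bilin (adjAction 𝕜 g) S F = comp (formalAdjoint S) F
      + comp F (transpose (formalAdjoint S)) := by
  funext n
  rw [Pi.add_apply, comp_apply, comp_apply,
    sum_antidiagonal_comm (fun x y => F x ∘ₗ transpose (formalAdjoint (𝕜 := 𝕜) S) y),
    ← Finset.sum_add_distrib]
  rfl

theorem map_inclAdjoint_comp (F : FormalMap ι (g →ₗ[𝕜] g))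
    (A : FormalMap ι (Dual 𝕜 l →ₗ[𝕜] g)) :
    map (inclAdjoint l) (comp F A)
      = comp (map (inclAdjoint l) A) (transpose F) := by
  funext n
  rw [map_apply, comp_apply, map_sum]
  simp only [inclAdjoint_comp]
  exact sum_antidiagonal_comm (fun x y => inclAdjoint l (A y) ∘ₗ (F x).dualMap) n

/-- Infinitesimal `l`-equivariance of a formal map to `g`: `d_p S (ad*_z p) = [S_p, z]`. -/
def IsEquivariant (S : FormalMap ι g) : Prop :=
  ∀ (z : l) (n : ι →₀ ℕ), fieldDeriv b (adStarPoint b z) S n = ⁅S n, (z : g)⁆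

variable {b}

theorem adStarPoint_apply (z : l) (n : ι →₀ ℕ) (y : l) :
    adStarPoint b z n y = point b n ⁅z, y⁆ := rfl

/-- For `Z_p = (d_p S)* ξ` one has `ad*_{Z_p} p = - i* ad*_{S_p} ξ`. -/
theorem IsEquivariant.sum_adStarPoint {S : FormalMap ι g} (hS : IsEquivariant b S)
    (ξ : Dual 𝕜 g) (n : ι →₀ ℕ) :
    ∑ q ∈ antidiagonal n, adStarPoint b (dualVec (differential b S q.1) ξ) q.2
      = - restrictDual l (adStar 𝕜 (S n) ξ) := by
  ext z
  rw [LinearMap.neg_apply, restrictDual_apply, adStar_apply, ← hS, fieldDeriv_apply, map_sum,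
    LinearMap.sum_apply, ← Finset.sum_neg_distrib]
  refine Finset.sum_congr rfl fun q _ => ?_
  rw [← differential_apply, ← dual_dualVec, adStarPoint_apply, adStarPoint_apply, ← lie_skew,
    map_neg]

/-- Equivariance is used twice. With Z = (d_p S)*ξ in l, it first gives i* ad*_S ξ = -ad*_Z p, and
then d_p S(ad*_Z p) = [S_p, Z]. The resulting relation dS i* ad*_S + ad_S i (dS)* = 0 is what makes
θ integrable in closed form in `theta_eq`. -/
theorem IsEquivariant.comp_differential {S : FormalMap ι g} (hS : IsEquivariant b S) :
    comp (differential b S) (comp (const ι (restrictDual l))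
        (transpose (formalAdjoint S)))
      + comp (formalAdjoint S) (map (inclAdjoint l) (differential b S)) = 0 := by
  funext n
  ext ξ
  rw [Pi.add_apply, comp_apply, comp_apply]
  simp only [const_comp_apply, LinearMap.add_apply, LinearMap.sum_apply,
    LinearMap.comp_apply, map_apply, inclAdjoint_apply]
  have h1 : ∀ q : (ι →₀ ℕ) × (ι →₀ ℕ), differential b S q.1
      (restrictDual l (transpose (formalAdjoint S) q.2 ξ))
      = - ∑ s ∈ antidiagonal q.2, differential b S q.1
          (adStarPoint b (dualVec (differential b S s.1) ξ) s.2) := by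
    intro q
    rw [← map_sum, hS.sum_adStarPoint, map_neg, neg_neg]
    rfl
  simp only [h1, Finset.sum_neg_distrib]
  rw [sum_antidiagonal_left_comm (fun x y z => differential b S x
    (adStarPoint b (dualVec (differential b S y) ξ) z))]
  have h2 : ∀ q : (ι →₀ ℕ) × (ι →₀ ℕ), ∑ s ∈ antidiagonal q.2, differential b S s.1
      (adStarPoint b (dualVec (differential b S q.1) ξ) s.2)
      = ⁅S q.2, (dualVec (differential b S q.1) ξ : g)⁆ := fun q => hS _ _
  simp only [h2]
  rw [sum_antidiagonal_comm (fun x y => ⁅S y, (dualVec (differential b S x) ξ : g)⁆)]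
  exact neg_add_cancel _

end Formal

/-! ### The gauge transform as the time-one value of an affine flow. -/

section Flow

variable {𝕜 : Type*} [RCLike 𝕜] {g : Type*} [LieRing g] [LieAlgebra 𝕜 g]
  [FiniteDimensional 𝕜 g] {l : LieSubalgebra 𝕜 g} {ι : Type*} [Fintype ι] [DecidableEq ι]
  {b : Basis ι 𝕜 l}

section Affine

variable {V W : Type*} [AddCommGroup V] [Module 𝕜 V] [FiniteDimensional 𝕜 V] [AddCommGroup W]
  [Module 𝕜 W]

/-- The solution of the differential equation `F' = B (S, F) + c` with initial value `F₀`. -/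
def affineFlow (B : W →ₗ[𝕜] V →ₗ[𝕜] V) (S : FormalMap ι W) (F₀ c : FormalMap ι V) (t : 𝕜) :
    FormalMap ι V :=
  apply (flow (map B S) t) F₀ + apply (flowIntegral (map B S) t) c

theorem affineFlow_zero (B : W →ₗ[𝕜] V →ₗ[𝕜] V) (S : FormalMap ι W) (F₀ c : FormalMap ι V) :
    affineFlow B S F₀ c 0 = F₀ := by
  rw [affineFlow, flow_zero, flowIntegral_zero, const_id_apply, apply, bilin_zero_left, add_zero]

theorem hasWeakDerivAt_affineFlow (B : W →ₗ[𝕜] V →ₗ[𝕜] V) {S : FormalMap ι W} (hS : S 0 = 0)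
    (F₀ c : FormalMap ι V) (t : 𝕜) (n : ι →₀ ℕ) :
    HasWeakDerivAt (fun s => affineFlow B S F₀ c s n)
      ((bilin B S (affineFlow B S F₀ c t) + c) n) t := by
  have hT : map B S 0 = 0 := by rw [map_apply, hS, map_zero]
  have h1 := hasWeakDerivAt_apply (hasWeakDerivAt_flow hT t)
    (G' := 0) (fun k => HasWeakDerivAt.const (F₀ k) t) n
  have h2 := hasWeakDerivAt_apply (hasWeakDerivAt_flowIntegral (map B S) t)
    (G' := 0) (fun k => HasWeakDerivAt.const (c k) t) n
  refine (h1.add h2).congr_deriv ?_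
  rw [← Pi.add_apply]
  refine congrFun ?_ n
  rw [affineFlow, apply_comp, apply_zero, apply_zero, bilin_add_right, ← apply_map, ← apply_map,
    ← apply_comp _ (flowIntegral _ _)]
  nth_rw 2 [flow_eq_add hT]
  rw [FormalMap.add_apply, const_id_apply]
  abel

/-- The difference of two solutions solves the homogeneous equation with initial value 0. This
identifies closed expressions by computing one derivative. -/
theorem eq_affineFlow {B : W →ₗ[𝕜] V →ₗ[𝕜] V} {S : FormalMap ι W} (hS : S 0 = 0)
    {c : FormalMap ι V} {F : 𝕜 → FormalMap ι V}
    (h : ∀ t n, HasWeakDerivAt (fun s => F s n) ((bilin B S (F t) + c) n) t) (t : 𝕜) :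
    F t = affineFlow B S (F 0) c t := by
  rw [← sub_eq_zero]
  refine eq_zero_of_hasWeakDerivAt (B := B) hS (F := fun s => F s - affineFlow B S (F 0) c s)
    (by rw [affineFlow_zero, sub_self]) (fun s n => ?_) t
  refine ((h s n).sub (hasWeakDerivAt_affineFlow B hS (F 0) c s n)).congr_deriv ?_
  rw [bilin_sub_right]
  simp only [Pi.add_apply, Pi.sub_apply]
  abel

end Affine

/-- The path e^(t ad_S) r (e^(t ad_S))* starts at r, and its derivative is ρ_S applied to itself. -/
theorem comp_exp_eq {S : FormalMap ι g} (hS : S 0 = 0) (r : FormalMap ι (Dual 𝕜 g →ₗ[𝕜] g)) :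
    comp (formalAd S) (comp r (formalAdStar S)) = apply (exp (map (adjAction 𝕜 g) S)) r := by
  have hT := formalAdjoint_zero (𝕜 := 𝕜) hS
  set E : 𝕜 → FormalMap ι (g →ₗ[𝕜] g) := flow (formalAdjoint S) with hE
  have h := eq_affineFlow (B := adjAction 𝕜 g) hS (c := 0)
    (F := fun t => comp (E t) (comp r (transpose (E t)))) (fun t n => ?_) 1
  · have h1 : comp (formalAd S) (comp r (formalAdStar S))
        = comp (E 1) (comp r (transpose (E 1))) := by
      rw [hE, flow_one]; rfl
    rw [h1, h, affineFlow, apply_zero, add_zero, flow_one, hE, flow_zero,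
      const_id_comp, transpose_const_id, comp_const_id]
  · have hf := hasWeakDerivAt_flow hT t
    have hr := hasWeakDerivAt_comp (F' := 0) (fun k => HasWeakDerivAt.const (r k) t)
      (hasWeakDerivAt_transpose hf)
    refine (hasWeakDerivAt_comp hf hr n).congr_deriv ?_
    refine congrFun ?_ n
    rw [bilin_adjAction, transpose_comp, comp_assoc, zero_comp, zero_add, add_zero, comp_assoc,
      comp_assoc]

/-- With R_t = ((e^(t ad_S) - 1)/ad_S) dS, the path R_t i* (e^(t ad_S))* - i R_t* starts at 0 and
has constant source dS i* - i (dS)* in its affine equation. Its value at t = 1 is θ. -/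
theorem theta_eq {S : FormalMap ι g} (hS : S 0 = 0) (hS' : IsEquivariant b S) :
    theta b S = apply (expDiv (map (adjAction 𝕜 g) S)) (map (skewPart l) (differential b S)) := by
  have hT := formalAdjoint_zero (𝕜 := 𝕜) hS
  set T := formalAdjoint (𝕜 := 𝕜) S with hTdef
  set A := differential b S with hA
  let R : 𝕜 → FormalMap ι (Dual 𝕜 l →ₗ[𝕜] g) := fun t => comp (flowIntegral T t) A
  let c : FormalMap ι (Dual 𝕜 g →ₗ[𝕜] Dual 𝕜 l) := const ι (restrictDual l)
  have h := eq_affineFlow (B := adjAction 𝕜 g) hS (c := map (skewPart l) A)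
    (F := fun t => comp (R t) (comp c (transpose (flow T t))) - map (inclAdjoint l) (R t))
    (fun t n => ?_) 1
  · have h1 : theta b S = comp (R 1) (comp c (transpose (flow T 1))) - map (inclAdjoint l) (R 1) := by
      simp only [R, flow_one, flowIntegral_one]; rfl
    rw [h1, h, affineFlow, flowIntegral_one]
    have h0 : R 0 = 0 := by
      simp only [R, flowIntegral_zero, zero_comp]
    rw [h0, map_zero_right, zero_comp, sub_zero, apply_zero, zero_add]
  · have hR : ∀ k, HasWeakDerivAt (fun s => R s k) ((comp (flow T t) A) k) t := by
      intro k
      refine (hasWeakDerivAt_comp (G' := 0) (hasWeakDerivAt_flowIntegral T t)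
        (fun j => HasWeakDerivAt.const (A j) t) k).congr_deriv ?_
      rw [comp_zero, add_zero]
    have hc := hasWeakDerivAt_comp (F' := 0) (fun k => HasWeakDerivAt.const (c k) t)
      (hasWeakDerivAt_transpose (hasWeakDerivAt_flow hT t))
    refine ((hasWeakDerivAt_comp hR hc n).sub ((hR n).map (inclAdjoint l))).congr_deriv ?_
    rw [← map_apply, ← Pi.sub_apply]
    refine congrFun ?_ n
    have e1 : comp (flow T t) A = A + comp T (R t) := by
      rw [flow_eq_add hT, add_comp, const_id_comp, comp_assoc]
    have e2 : transpose (flow T t)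
        = const ι LinearMap.id + comp (transpose T) (transpose (flowIntegral T t)) := by
      rw [flow_eq_add hT, transpose_add, transpose_const_id, flowIntegral, comp_series_comm _ hT,
        transpose_comp]
    have e3 : map (inclAdjoint l) (R t)
        = comp (map (inclAdjoint l) A) (transpose (flowIntegral T t)) :=
      map_inclAdjoint_comp _ _
    have e4 := hS'.comp_differential
    -- The derivative yields dS i* (e^(tT))*, whereas the source must not depend on t.
    -- `comp_differential` shows that the excess is -T i R_t*, which is the missing part of the
    -- action of T.
    have e5 : comp A (comp c (transpose (flow T t))) + comp T (map (inclAdjoint l) (R t))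
        = comp A c := by
      have := congrArg (fun M => comp M (transpose (flowIntegral T t))) e4
      simp only [add_comp, zero_comp, comp_assoc] at this
      rw [e3, e2]
      simp only [comp_add, comp_const_id]
      rw [add_assoc, this, add_zero]
    have e6 : map (skewPart l) A = comp A c - map (inclAdjoint l) A := by
      rw [comp, bilin_const_right]; rfl
    rw [e6, ← e5, e1, bilin_adjAction, transpose_comp, map_add_right, map_inclAdjoint_comp]
    simp only [add_comp, sub_comp, comp_sub, zero_comp, zero_add, comp_assoc, ← hTdef]
    abel

end Flow

/-! ### Algebraic identities for the Yang--Baxter expression. -/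

section Pointwise

variable {𝕜 : Type*} [Field 𝕜] {g : Type*} [LieRing g] [LieAlgebra 𝕜 g]
  [FiniteDimensional 𝕜 g] {l : LieSubalgebra 𝕜 g}

theorem dual_contract (φ : Dual 𝕜 g [⋀^Fin 3]→ₗ[𝕜] 𝕜) (ξ η ζ : Dual 𝕜 g) :
    ζ (contract φ ξ η) = φ ![ξ, η, ζ] := by
  have h : Function.update ![ξ, η, 0] 2 ζ = ![ξ, η, ζ] := by
    funext i; fin_cases i <;> simp
  simp [contract, h]

/-- Compatibility of the Lie bracket with the action on linear maps `g* → g`. -/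
theorem lie_adjAction_identity (x : g) (s t : Dual 𝕜 g →ₗ[𝕜] g) (ξ η ζ : Dual 𝕜 g) :
    ζ ⁅adjAction 𝕜 g x s ξ, t η⁆ + ζ ⁅s ξ, adjAction 𝕜 g x t η⁆
      = ζ ⁅s (adStar 𝕜 x ξ), t η⁆ + ζ ⁅s ξ, t (adStar 𝕜 x η)⁆ + adStar 𝕜 x ζ ⁅s ξ, t η⁆ := by
  simp only [adjAction_apply, add_lie, lie_add, map_add, adStar_apply, lie_lie, map_sub]
  ring

/-- The action of the values of `t` on `s`, cyclically summed. -/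
theorem cyclic_adjAction_identity (s t : Dual 𝕜 g →ₗ[𝕜] g) (ξ η ζ : Dual 𝕜 g) :
    (ζ ⁅t ξ, s η⁆ + ζ ⁅s ξ, t η⁆) + (ξ ⁅t η, s ζ⁆ + ξ ⁅s η, t ζ⁆) + (η ⁅t ζ, s ξ⁆ + η ⁅s ζ, t ξ⁆)
      - (ζ (adjAction 𝕜 g (t ξ) s η) + ξ (adjAction 𝕜 g (t η) s ζ)
        + η (adjAction 𝕜 g (t ζ) s ξ))
      = - (ζ (s (adStar 𝕜 (t ξ) η)) + adStar 𝕜 (t ξ) η (s ζ))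
        - (ξ (s (adStar 𝕜 (t η) ζ)) + adStar 𝕜 (t η) ζ (s ξ))
        - (η (s (adStar 𝕜 (t ζ) ξ)) + adStar 𝕜 (t ζ) ξ (s η)) := by
  simp only [adjAction_apply, map_add, adStar_apply]
  rw [← lie_skew (s ξ), ← lie_skew (s η), ← lie_skew (s ζ)]
  simp only [map_neg]
  ring

/-- The restriction i* intertwines the coadjoint actions of z on g* and l*, because l is a
subalgebra. -/
theorem adjAction_skewPart (z : l) (A : Dual 𝕜 l →ₗ[𝕜] g) :
    adjAction 𝕜 g z (skewPart l A)
      = skewPart l ((LieAlgebra.ad 𝕜 g z : g →ₗ[𝕜] g) ∘ₗ A + A ∘ₗ adStar 𝕜 z) := by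
  ext ξ
  rw [← sub_eq_zero, ← Module.forall_dual_apply_eq_zero_iff 𝕜]
  intro η
  have h : ∀ θ : Dual 𝕜 g, restrictDual l (adStar 𝕜 (z : g) θ)
      = adStar 𝕜 z (restrictDual l θ) := by
    intro θ; ext y; rfl
  simp only [map_sub, adjAction_apply, map_add]
  rw [← adStar_apply, LinearMap.add_apply, map_add, dual_skewPart, dual_skewPart, dual_skewPart,
    dual_skewPart, h, h]
  simp only [LinearMap.comp_apply, LieAlgebra.ad_apply, adStar_apply]
  ring

namespace LieQuasiBialgebra

variable (G : LieQuasiBialgebra 𝕜 g)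

/-- The consequence of the cocycle property of `ϖ` for a linear map `t : g* → g`. -/
theorem cyclic_cocycle (x : g) (t : Dual 𝕜 g →ₗ[𝕜] g) (ξ η ζ : Dual 𝕜 g) :
    (ζ ⁅G.ϖ x ξ, t η⁆ + ζ ⁅t ξ, G.ϖ x η⁆ + ζ (G.ϖ (adjAction 𝕜 g x t ξ) η))
      + (ξ ⁅G.ϖ x η, t ζ⁆ + ξ ⁅t η, G.ϖ x ζ⁆ + ξ (G.ϖ (adjAction 𝕜 g x t η) ζ))
      + (η ⁅G.ϖ x ζ, t ξ⁆ + η ⁅t ζ, G.ϖ x ξ⁆ + η (G.ϖ (adjAction 𝕜 g x t ζ) ξ))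
      = (ζ (G.ϖ (t (adStar 𝕜 x ξ)) η) + ζ (G.ϖ (t ξ) (adStar 𝕜 x η))
          + adStar 𝕜 x ζ (G.ϖ (t ξ) η))
        + (ξ (G.ϖ (t (adStar 𝕜 x η)) ζ) + ξ (G.ϖ (t η) (adStar 𝕜 x ζ))
          + adStar 𝕜 x ξ (G.ϖ (t η) ζ))
        + (η (G.ϖ (t (adStar 𝕜 x ζ)) ξ) + η (G.ϖ (t ζ) (adStar 𝕜 x ξ))
          + adStar 𝕜 x η (G.ϖ (t ζ) ξ)) := by
  have h : ∀ y : g, ∀ α β : Dual 𝕜 g, α (G.ϖ x (adStar 𝕜 y β)) = - β ⁅y, G.ϖ x α⁆ := by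
    intro y α β
    rw [G.skew, adStar_apply]
  simp only [adjAction_apply, map_add, LinearMap.add_apply, G.cocycle, LinearMap.sub_apply,
    map_sub, h, adStar_apply]
  rw [← lie_skew (G.ϖ x ξ), ← lie_skew (G.ϖ x η), ← lie_skew (G.ϖ x ζ)]
  simp only [map_neg]
  ring

/-- The consequence of the Jacobi identity of the double for `x ∈ g` and `ξ, η ∈ g*`. -/
theorem cyclic_jacobi (x : g) (ξ η ζ : Dual 𝕜 g) :
    ζ (G.ϖ (G.ϖ x ξ) η) + ξ (G.ϖ (G.ϖ x η) ζ) + η (G.ϖ (G.ϖ x ζ) ξ)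
      = G.φ ![adStar 𝕜 x ξ, η, ζ] + G.φ ![ξ, adStar 𝕜 x η, ζ] + G.φ ![ξ, η, adStar 𝕜 x ζ] := by
  -- Only the g-component of the Jacobi identity is needed, paired with ζ.
  have h := congrArg (fun p => ζ p.1) (G.jacobi (x, 0) (0, ξ) (0, η))
  have hc : ∀ α : Dual 𝕜 g, contract G.φ 0 α = 0 := by
    intro α
    rw [← Module.forall_dual_apply_eq_zero_iff 𝕜]
    intro β
    rw [dual_contract]
    exact G.φ.map_coord_zero 0 rfl
  have hc' : ∀ α : Dual 𝕜 g, contract G.φ α 0 = 0 := by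
    intro α
    rw [← Module.forall_dual_apply_eq_zero_iff 𝕜]
    intro β
    rw [dual_contract]
    exact G.φ.map_coord_zero 1 rfl
  have hneg : ∀ α : Dual 𝕜 g, contract G.φ η (-α) = - contract G.φ η α := by
    intro α
    rw [← sub_eq_zero, ← Module.forall_dual_apply_eq_zero_iff 𝕜]
    intro β
    rw [map_sub, map_neg, dual_contract, dual_contract]
    have := G.φ.map_update_smul ![η, α, β] 1 (-1 : 𝕜) α
    have e1 : Function.update ![η, α, β] 1 ((-1 : 𝕜) • α) = ![η, -α, β] := by
      rw [neg_one_smul 𝕜 α]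
      funext i; fin_cases i <;> simp
    have e2 : Function.update ![η, α, β] 1 α = ![η, α, β] := by
      funext i; fin_cases i <;> simp
    rw [e1, e2] at this
    rw [this]; simp
  have hsw : G.φ ![η, adStar 𝕜 x ξ, ζ] = - G.φ ![adStar 𝕜 x ξ, η, ζ] := by
    have := G.φ.map_swap ![adStar 𝕜 x ξ, η, ζ] (i := 0) (j := 1) (by decide)
    rw [← this]
    congr 1
    funext i; fin_cases i <;> rfl
  have h0 : adStar 𝕜 (0 : g) = 0 := by ext; simp [adStar_apply]
  simp only [doubleBracket, hc, hc', h0, hneg, map_zero, LinearMap.zero_apply, lie_zero, zero_lie,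
    add_zero, zero_add, sub_zero, zero_sub, neg_zero, LinearMap.zero_comp, LinearMap.comp_zero,
    LinearMap.neg_comp, map_neg, LinearMap.neg_apply, neg_neg, Prod.fst_add, Prod.fst_zero,
    map_add, dual_contract, hsw] at h
  rw [G.skew x ζ] at h
  simp only [LinearMap.comp_apply, LinearMap.flip_apply] at h
  rw [← adStar_apply, dual_contract, G.skew (G.ϖ x η) ζ] at h
  linear_combination -h

end LieQuasiBialgebra

end Pointwise

/-! ### Equivariance of the infinitesimal gauge action. -/

section Formal

open Finset.HasAntidiagonal (antidiagonal mem_antidiagonal)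

variable {𝕜 : Type*} [Field 𝕜] {g : Type*} [LieRing g] [LieAlgebra 𝕜 g]
  [FiniteDimensional 𝕜 g] {l : LieSubalgebra 𝕜 g} {ι : Type*} [Fintype ι] [DecidableEq ι]
  {b : Basis ι 𝕜 l}

namespace FormalMap

theorem pderiv_comm {V : Type*} [AddCommGroup V] [Module 𝕜 V] (i j : ι) (F : FormalMap ι V) :
    pderiv 𝕜 i (pderiv 𝕜 j F) = pderiv 𝕜 j (pderiv 𝕜 i F) := by
  funext n
  by_cases hij : i = j
  · rw [hij]
  · simp only [pderiv_apply, smul_smul, Finsupp.add_apply, Finsupp.single_apply, if_neg hij,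
      if_neg (Ne.symm hij), add_zero, add_right_comm n]
    rw [mul_comm]

theorem dirDeriv_differential {E V : Type*} [AddCommGroup E] [Module 𝕜 E] [AddCommGroup V]
    [Module 𝕜 V] (b : Basis ι 𝕜 E) (F : FormalMap ι V) (α β : Dual 𝕜 E) (n : ι →₀ ℕ) :
    dirDeriv b (differential b F) α n β = ∑ i, ∑ j, (α (b i) * β (b j)) •
      pderiv 𝕜 i (pderiv 𝕜 j F) n := by
  simp [dirDeriv_eq_sum, pderiv_apply, differential_apply, Finset.smul_sum, smul_smul,
    mul_assoc, mul_comm, mul_left_comm]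

theorem dirDeriv_differential_comm {E V : Type*} [AddCommGroup E] [Module 𝕜 E] [AddCommGroup V]
    [Module 𝕜 V] (b : Basis ι 𝕜 E) (F : FormalMap ι V) (α β : Dual 𝕜 E) (n : ι →₀ ℕ) :
    dirDeriv b (differential b F) α n β = dirDeriv b (differential b F) β n α := by
  rw [dirDeriv_differential, dirDeriv_differential, Finset.sum_comm]
  simp only [mul_comm, pderiv_comm]

/-- Symmetry of second derivatives exchanges the direction α with the field P; the extra term comes
from differentiating P. -/
theorem dirDeriv_fieldDeriv {E V : Type*} [AddCommGroup E] [Module 𝕜 E] [AddCommGroup V]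
    [Module 𝕜 V] (b : Basis ι 𝕜 E) (P : FormalMap ι (Dual 𝕜 E)) (F : FormalMap ι V)
    (α : Dual 𝕜 E) (n : ι →₀ ℕ) :
    dirDeriv b (fieldDeriv b P F) α n
      = fieldDeriv b P (differential b F) n α + apply (differential b F) (dirDeriv b P α) n := by
  rw [fieldDeriv, apply, dirDeriv_bilin, Pi.add_apply, fieldDeriv_apply, LinearMap.sum_apply]
  congr 1
  exact Finset.sum_congr rfl fun q _ => dirDeriv_differential_comm b F _ _ _

end FormalMap

theorem dirDeriv_adStarPoint (z : l) (α : Dual 𝕜 l) :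
    dirDeriv b (adStarPoint b z) α = const ι (adStar 𝕜 z α) := by
  funext n
  rw [adStarPoint, dirDeriv_map, dirDeriv_point]
  simp only [const_apply]
  split_ifs <;> simp

/-- `l`-equivariance of a formal map to `L(g*, g)`. -/
def IsEquivariantMatrix (b : Basis ι 𝕜 l) (F : FormalMap ι (Dual 𝕜 g →ₗ[𝕜] g)) : Prop :=
  ∀ z : l, fieldDeriv b (adStarPoint b z) F + map (adjAction 𝕜 g z) F = 0

theorem IsEquivariantMatrix.add {F F' : FormalMap ι (Dual 𝕜 g →ₗ[𝕜] g)}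
    (hF : IsEquivariantMatrix b F) (hF' : IsEquivariantMatrix b F') :
    IsEquivariantMatrix b (F + F') := by
  intro z
  rw [fieldDeriv_add, map_add_right, add_add_add_comm, hF, hF', add_zero]

theorem IsEquivariantMatrix.sub {F F' : FormalMap ι (Dual 𝕜 g →ₗ[𝕜] g)}
    (hF : IsEquivariantMatrix b F) (hF' : IsEquivariantMatrix b F') :
    IsEquivariantMatrix b (F - F') := by
  intro z
  rw [fieldDeriv_sub, map_sub_right, sub_add_sub_comm, hF, hF', sub_zero]

theorem IsEquivariant.fieldDeriv_eq {S : FormalMap ι g} (hS : IsEquivariant b S) (z : l) :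
    fieldDeriv b (adStarPoint b z) S = - map (LieAlgebra.ad 𝕜 g z : g →ₗ[𝕜] g) S := by
  funext n
  rw [hS, Pi.neg_apply, map_apply, ← lie_skew]
  rfl

/-- Differentiating the equivariance of S in a constant direction gives that of dS, and
skew-symmetrisation commutes with l. -/
theorem IsEquivariant.skewPart_differential {S : FormalMap ι g} (hS : IsEquivariant b S) :
    IsEquivariantMatrix b (map (skewPart l) (differential b S)) := by
  intro z
  rw [fieldDeriv_map]
  funext n
  rw [Pi.add_apply, map_apply, map_apply, map_apply, adjAction_skewPart, ← map_add, Pi.zero_apply]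
  convert LinearMap.map_zero _
  ext α
  have h1 := dirDeriv_fieldDeriv b (adStarPoint b z) S α n
  rw [dirDeriv_adStarPoint, apply_const, hS.fieldDeriv_eq] at h1
  have h2 : dirDeriv b (-map (LieAlgebra.ad 𝕜 g z : g →ₗ[𝕜] g) S) α n
      = - ⁅(z : g), dirDeriv b S α n⁆ := by
    rw [← zero_sub, dirDeriv_sub, Pi.sub_apply, dirDeriv_map]
    simp [dirDeriv, differential_zero]
  rw [h2] at h1
  simp only [LinearMap.add_apply, LinearMap.comp_apply, LinearMap.zero_apply]
  change _ + (⁅(z : g), dirDeriv b S α n⁆ + _) = 0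
  rw [add_left_comm]
  exact (congrArg _ h1.symm).trans (add_neg_cancel _)

/-- As ϖ_z = 0, the cocycle identity reduces to ϖ_[z,S] = ρ_z ϖ_S. -/
theorem IsEquivariant.map_cocycle (G : LieQuasiBialgebra 𝕜 g) (hϖ : ∀ z ∈ l, G.ϖ z = 0)
    {S : FormalMap ι g} (hS : IsEquivariant b S) : IsEquivariantMatrix b (map G.ϖ S) := by
  intro z
  rw [fieldDeriv_map, hS.fieldDeriv_eq]
  funext n
  simp only [Pi.add_apply, map_apply, Pi.neg_apply, map_neg, LieAlgebra.ad_apply, G.cocycle,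
    hϖ z z.2, map_zero, sub_zero]
  exact neg_add_cancel _

/-- The inhomogeneous term `d S i* - i (d S)* + ϖ_S` of the infinitesimal gauge action of `S`. -/
def gaugeSource (G : LieQuasiBialgebra 𝕜 g) (b : Basis ι 𝕜 l) (S : FormalMap ι g) :
    FormalMap ι (Dual 𝕜 g →ₗ[𝕜] g) :=
  map (skewPart l) (differential b S) + map G.ϖ S

theorem IsEquivariant.gaugeSource (G : LieQuasiBialgebra 𝕜 g) (hϖ : ∀ z ∈ l, G.ϖ z = 0)
    {S : FormalMap ι g} (hS : IsEquivariant b S) : IsEquivariantMatrix b (gaugeSource G b S) :=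
  hS.skewPart_differential.add (hS.map_cocycle G hϖ)

/-- For equivariant S, the operator measuring the failure of equivariance commutes with ρ_S: its two
contributions on S cancel. -/
theorem IsEquivariant.fieldDeriv_adjAction {S : FormalMap ι g} (hS : IsEquivariant b S)
    (F : FormalMap ι (Dual 𝕜 g →ₗ[𝕜] g)) (z : l) :
    fieldDeriv b (adStarPoint b z) (bilin (adjAction 𝕜 g) S F)
        + map (adjAction 𝕜 g z) (bilin (adjAction 𝕜 g) S F)
      = bilin (adjAction 𝕜 g) S
          (fieldDeriv b (adStarPoint b z) F + map (adjAction 𝕜 g z) F) := by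
  have h := bilin_leibniz (B := adjAction 𝕜 g) (D := adjAction 𝕜 g)
    (D₁ := (LieAlgebra.ad 𝕜 g : g →ₗ[𝕜] g →ₗ[𝕜] g)) (D₂ := adjAction 𝕜 g)
    adjAction_lie (const ι (z : g)) S F
  simp only [bilin_const_left] at h
  rw [h, fieldDeriv_bilin, hS.fieldDeriv_eq, bilin_add_right, ← zero_sub, bilin_sub_left,
    bilin_zero_left]
  change 0 - bilin (adjAction 𝕜 g) (map (LieAlgebra.ad 𝕜 g z : g →ₗ[𝕜] g) S) F + _
    + (bilin (adjAction 𝕜 g) (map (LieAlgebra.ad 𝕜 g z : g →ₗ[𝕜] g) S) F + _) = _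
  abel

end Formal

/-! ### Equivariance along the flow. -/

section Flow

open Finset.HasAntidiagonal (antidiagonal mem_antidiagonal)

variable {𝕜 : Type*} [RCLike 𝕜] {g : Type*} [LieRing g] [LieAlgebra 𝕜 g]
  [FiniteDimensional 𝕜 g] {l : LieSubalgebra 𝕜 g} {ι : Type*} [Fintype ι] [DecidableEq ι]
  {b : Basis ι 𝕜 l}

theorem hasWeakDerivAt_dirDeriv {E V : Type*} [AddCommGroup E] [Module 𝕜 E] [AddCommGroup V]
    [Module 𝕜 V] (b : Basis ι 𝕜 E) {F : 𝕜 → FormalMap ι V} {F' : FormalMap ι V} {t : 𝕜}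
    (hF : ∀ n, HasWeakDerivAt (fun s => F s n) (F' n) t) (α : Dual 𝕜 E) (n : ι →₀ ℕ) :
    HasWeakDerivAt (fun s => dirDeriv b (F s) α n) (dirDeriv b F' α n) t := by
  simp only [dirDeriv_eq_sum, pderiv_apply, smul_smul]
  exact HasWeakDerivAt.sum fun i _ => (hF _).map (LinearMap.lsmul 𝕜 V _)

theorem hasWeakDerivAt_fieldDeriv {E V : Type*} [AddCommGroup E] [Module 𝕜 E] [AddCommGroup V]
    [Module 𝕜 V] (b : Basis ι 𝕜 E) {F : 𝕜 → FormalMap ι V} {F' : FormalMap ι V} {t : 𝕜}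
    (hF : ∀ n, HasWeakDerivAt (fun s => F s n) (F' n) t) (P : FormalMap ι (Dual 𝕜 E))
    (n : ι →₀ ℕ) :
    HasWeakDerivAt (fun s => fieldDeriv b P (F s) n) (fieldDeriv b P F' n) t :=
  HasWeakDerivAt.sum fun _ _ => hasWeakDerivAt_dirDeriv b hF _ _

/-- The formal gauge transform in terms of logarithms. -/
theorem gaugeTransform_eq_affineFlow (G : LieQuasiBialgebra 𝕜 g) {S : FormalMap ι g}
    (hS0 : S 0 = 0) (hS : IsEquivariant b S) (r : FormalMap ι (Dual 𝕜 g →ₗ[𝕜] g)) :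
    comp (formalAd S) (comp r (formalAdStar S)) + theta b S + formalGroupCocycle G S
      = affineFlow (adjAction 𝕜 g) S r (gaugeSource G b S) 1 := by
  rw [comp_exp_eq hS0, theta_eq hS0 hS, formalGroupCocycle, affineFlow, flow_one,
    flowIntegral_one, gaugeSource, apply_add, add_assoc]

/-- The failure of equivariance along the flow solves the homogeneous equation F' = ρ_S F with
initial value 0, hence vanishes by uniqueness. -/
theorem IsEquivariantMatrix.affineFlow {S : FormalMap ι g}
    (hS0 : S 0 = 0) (hS : IsEquivariant b S) {r c : FormalMap ι (Dual 𝕜 g →ₗ[𝕜] g)}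
    (hr : IsEquivariantMatrix b r) (hc : IsEquivariantMatrix b c) (t : 𝕜) :
    IsEquivariantMatrix b (affineFlow (adjAction 𝕜 g) S r c t) := by
  intro z
  refine eq_zero_of_hasWeakDerivAt (B := adjAction 𝕜 g) hS0
    (F := fun s => fieldDeriv b (adStarPoint b z) (_root_.affineFlow (adjAction 𝕜 g) S r c s)
      + map (adjAction 𝕜 g z) (_root_.affineFlow (adjAction 𝕜 g) S r c s)) ?_ (fun s n => ?_) t
  · simp only [affineFlow_zero, hr z]
  · have h := hasWeakDerivAt_affineFlow (adjAction 𝕜 g) hS0 r c s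
    refine ((hasWeakDerivAt_fieldDeriv b h _ n).add ((h n).map (adjAction 𝕜 g z))).congr_deriv ?_
    rw [← map_apply, ← Pi.add_apply]
    refine congrFun ?_ n
    rw [fieldDeriv_add, map_add_right, add_add_add_comm, hc z, add_zero,
      hS.fieldDeriv_adjAction]

end Flow

theorem FormalMap.sum_antidiagonal_const {ι V : Type*} [DecidableEq ι] [AddCommGroup V]
    (f : (ι →₀ ℕ) → V) (n : ι →₀ ℕ) :
    ∑ q ∈ Finset.HasAntidiagonal.antidiagonal n, const ι (f q.1) q.2 = f n := by
  rw [sum_antidiagonal_comm (fun x y => const ι (f x) y),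
    sum_antidiagonal_eq_zero_left (fun x y => const ι (f y) x)]
  · simp [const_apply]
  · intro q _ hq; simp [const_apply, hq]

/-! ### Variation of the Yang--Baxter equation under infinitesimal gauge transformations. -/

section Formal

open Finset.HasAntidiagonal (antidiagonal mem_antidiagonal)

variable {𝕜 : Type*} [Field 𝕜] {g : Type*} [LieRing g] [LieAlgebra 𝕜 g]
  [FiniteDimensional 𝕜 g] {l : LieSubalgebra 𝕜 g} {ι : Type*} [Fintype ι] [DecidableEq ι]
  (G : LieQuasiBialgebra 𝕜 g) (b : Basis ι 𝕜 l)

/-- The formal map `p ↦ ⟨ζ, [F_p ξ, F'_p η]⟩`. -/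
def formalBracket (F F' : FormalMap ι (Dual 𝕜 g →ₗ[𝕜] g)) (ξ η ζ : Dual 𝕜 g) : FormalMap ι 𝕜 :=
  fun n => ∑ q ∈ antidiagonal n, ζ ⁅F q.1 ξ, F' q.2 η⁆

theorem cdybeTerm_apply (F : FormalMap ι (Dual 𝕜 g →ₗ[𝕜] g)) (ξ η ζ : Dual 𝕜 g) (n : ι →₀ ℕ) :
    cdybeTerm G b F ξ η ζ n = ζ (dirDeriv b F (restrictDual l ξ) n η)
      - formalBracket F F ξ η ζ n - ζ (G.ϖ (F n ξ) η) := by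
  rw [cdybeTerm, bilin_apply, map_sum]; rfl

/-- The difference of the two sides of the generalised dynamical Yang--Baxter equation. -/
def cdybeDefect (F : FormalMap ι (Dual 𝕜 g →ₗ[𝕜] g)) (ξ η ζ : Dual 𝕜 g) : FormalMap ι 𝕜 :=
  cdybeTerm G b F ξ η ζ + cdybeTerm G b F η ζ ξ + cdybeTerm G b F ζ ξ η
    - const ι (G.φ ![ξ, η, ζ])

/-- The derivative of `cdybeTerm` at `F` in the direction `M`. -/
def cdybeVariation (F M : FormalMap ι (Dual 𝕜 g →ₗ[𝕜] g)) (ξ η ζ : Dual 𝕜 g) :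
    FormalMap ι 𝕜 :=
  fun n => ζ (dirDeriv b M (restrictDual l ξ) n η)
    - (formalBracket M F ξ η ζ n + formalBracket F M ξ η ζ n) - ζ (G.ϖ (M n ξ) η)

theorem formalBracket_add_left (F F' H : FormalMap ι (Dual 𝕜 g →ₗ[𝕜] g)) (ξ η ζ : Dual 𝕜 g) :
    formalBracket (F + F') H ξ η ζ = formalBracket F H ξ η ζ + formalBracket F' H ξ η ζ := by
  funext n
  simp [formalBracket, Finset.sum_add_distrib]

theorem formalBracket_add_right (F F' H : FormalMap ι (Dual 𝕜 g →ₗ[𝕜] g)) (ξ η ζ : Dual 𝕜 g) :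
    formalBracket H (F + F') ξ η ζ = formalBracket H F ξ η ζ + formalBracket H F' ξ η ζ := by
  funext n
  simp [formalBracket, Finset.sum_add_distrib]

theorem cdybeVariation_add (F M M' : FormalMap ι (Dual 𝕜 g →ₗ[𝕜] g)) (ξ η ζ : Dual 𝕜 g) :
    cdybeVariation G b F (M + M') ξ η ζ
      = cdybeVariation G b F M ξ η ζ + cdybeVariation G b F M' ξ η ζ := by
  funext n
  simp only [cdybeVariation, formalBracket_add_left, formalBracket_add_right, dirDeriv_add,
    Pi.add_apply, LinearMap.add_apply, map_add]
  ring

/-- By the Jacobi identity, acting by S on both entries of the bracket amounts to acting coadjointly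
on ξ, η and ζ. -/
theorem formalBracket_adjAction (S : FormalMap ι g) (F : FormalMap ι (Dual 𝕜 g →ₗ[𝕜] g))
    (ξ η ζ : Dual 𝕜 g) (n : ι →₀ ℕ) :
    formalBracket (bilin (adjAction 𝕜 g) S F) F ξ η ζ n
        + formalBracket F (bilin (adjAction 𝕜 g) S F) ξ η ζ n
      = ∑ q ∈ antidiagonal n, (formalBracket F F (adStar 𝕜 (S q.1) ξ) η ζ q.2
        + formalBracket F F ξ (adStar 𝕜 (S q.1) η) ζ q.2
        + formalBracket F F ξ η (adStar 𝕜 (S q.1) ζ) q.2) := by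
  simp only [formalBracket, bilin_apply, LinearMap.sum_apply, map_sum, sum_lie,
    lie_sum]
  rw [sum_antidiagonal_assoc (fun x y z => ζ ⁅adjAction 𝕜 g (S x) (F y) ξ, F z η⁆),
    sum_antidiagonal_left_comm (fun x y z => ζ ⁅F x ξ, adjAction 𝕜 g (S y) (F z) η⁆)]
  simp only [← Finset.sum_add_distrib]
  exact Finset.sum_congr rfl fun q _ => Finset.sum_congr rfl fun s _ =>
    lie_adjAction_identity _ _ _ _ _ _

theorem formalBracket_add_swap (F M : FormalMap ι (Dual 𝕜 g →ₗ[𝕜] g)) (ξ η ζ : Dual 𝕜 g)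
    (n : ι →₀ ℕ) :
    formalBracket M F ξ η ζ n + formalBracket F M ξ η ζ n
      = ∑ q ∈ antidiagonal n, (ζ ⁅M q.1 ξ, F q.2 η⁆ + ζ ⁅F q.2 ξ, M q.1 η⁆) := by
  rw [Finset.sum_add_distrib, sum_antidiagonal_comm (fun x y => ζ ⁅F y ξ, M x η⁆)]; rfl

/-- The variation of the Yang--Baxter equation under the linear part of the infinitesimal gauge
action and the cocycle. -/
theorem cyclic_cdybeVariation_cocycle {S : FormalMap ι g}
    (F : FormalMap ι (Dual 𝕜 g →ₗ[𝕜] g)) (ξ η ζ : Dual 𝕜 g) (n : ι →₀ ℕ) :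
    (formalBracket (map G.ϖ S) F ξ η ζ n + formalBracket F (map G.ϖ S) ξ η ζ n
        + ζ (G.ϖ (bilin (adjAction 𝕜 g) S F n ξ) η))
      + (formalBracket (map G.ϖ S) F η ζ ξ n + formalBracket F (map G.ϖ S) η ζ ξ n
        + ξ (G.ϖ (bilin (adjAction 𝕜 g) S F n η) ζ))
      + (formalBracket (map G.ϖ S) F ζ ξ η n + formalBracket F (map G.ϖ S) ζ ξ η n
        + η (G.ϖ (bilin (adjAction 𝕜 g) S F n ζ) ξ))
      = ∑ q ∈ antidiagonal n, ((ζ (G.ϖ (F q.2 (adStar 𝕜 (S q.1) ξ)) η)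
            + ζ (G.ϖ (F q.2 ξ) (adStar 𝕜 (S q.1) η)) + adStar 𝕜 (S q.1) ζ (G.ϖ (F q.2 ξ) η))
          + (ξ (G.ϖ (F q.2 (adStar 𝕜 (S q.1) η)) ζ) + ξ (G.ϖ (F q.2 η) (adStar 𝕜 (S q.1) ζ))
            + adStar 𝕜 (S q.1) ξ (G.ϖ (F q.2 η) ζ))
          + (η (G.ϖ (F q.2 (adStar 𝕜 (S q.1) ζ)) ξ) + η (G.ϖ (F q.2 ζ) (adStar 𝕜 (S q.1) ξ))
            + adStar 𝕜 (S q.1) η (G.ϖ (F q.2 ζ) ξ))) := by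
  simp only [formalBracket_add_swap, bilin_apply, LinearMap.sum_apply, map_sum]
  simp only [← Finset.sum_add_distrib]
  exact Finset.sum_congr rfl fun q _ => G.cyclic_cocycle _ _ _ _ _

variable {b}

/-- For Z = (d_p S)*ξ, equivariance of F gives ρ_Z F = -dF(ad*_Z p), and equivariance of S gives
ad*_Z p = -i* ad*_S ξ. -/
theorem IsEquivariantMatrix.sum_adjAction_dualVec {S : FormalMap ι g} (hS : IsEquivariant b S)
    {F : FormalMap ι (Dual 𝕜 g →ₗ[𝕜] g)} (hF : IsEquivariantMatrix b F) (ξ : Dual 𝕜 g)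
    (n : ι →₀ ℕ) :
    ∑ q ∈ antidiagonal n, adjAction 𝕜 g (dualVec (differential b S q.1) ξ : g) (F q.2)
      = ∑ q ∈ antidiagonal n, dirDeriv b F (restrictDual l (adStar 𝕜 (S q.1) ξ)) q.2 := by
  have h1 : ∀ q : (ι →₀ ℕ) × (ι →₀ ℕ),
      adjAction 𝕜 g (dualVec (differential b S q.1) ξ : g) (F q.2)
        = - ∑ s ∈ antidiagonal q.2, differential b F s.1
          (adStarPoint b (dualVec (differential b S q.1) ξ) s.2) := by
    intro q
    have := congrFun (hF (dualVec (differential b S q.1) ξ)) q.2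
    exact eq_neg_of_add_eq_zero_right this
  simp only [h1, Finset.sum_neg_distrib]
  rw [sum_antidiagonal_left_comm (fun x y z => differential b F y
    (adStarPoint b (dualVec (differential b S x) ξ) z)), ← Finset.sum_neg_distrib,
    sum_antidiagonal_comm (fun x y => dirDeriv b F (restrictDual l (adStar 𝕜 (S x) ξ)) y)]
  refine Finset.sum_congr rfl fun q _ => ?_
  rw [← map_sum, hS.sum_adStarPoint, map_neg, neg_neg]
  rfl

variable (b)

/-- This is d² = 0: by symmetry of second derivatives, the six terms cancel in pairs. -/
theorem cyclic_skewPart_differential (S : FormalMap ι g) (ξ η ζ : Dual 𝕜 g) (n : ι →₀ ℕ) :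
    ζ (dirDeriv b (map (skewPart l) (differential b S)) (restrictDual l ξ) n η)
      + ξ (dirDeriv b (map (skewPart l) (differential b S)) (restrictDual l η) n ζ)
      + η (dirDeriv b (map (skewPart l) (differential b S)) (restrictDual l ζ) n ξ) = 0 := by
  simp only [dirDeriv_map, dual_skewPart]
  rw [dirDeriv_differential_comm b S (restrictDual l ξ) (restrictDual l η),
    dirDeriv_differential_comm b S (restrictDual l η) (restrictDual l ζ),
    dirDeriv_differential_comm b S (restrictDual l ζ) (restrictDual l ξ)]
  ring

theorem dual_dirDeriv_adjAction (S : FormalMap ι g) (F : FormalMap ι (Dual 𝕜 g →ₗ[𝕜] g))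
    (α : Dual 𝕜 l) (η ζ : Dual 𝕜 g) (n : ι →₀ ℕ) :
    ζ (dirDeriv b (bilin (adjAction 𝕜 g) S F) α n η)
      = ∑ q ∈ antidiagonal n, ζ (adjAction 𝕜 g (differential b S q.1 α) (F q.2) η)
        + ∑ q ∈ antidiagonal n, (adStar 𝕜 (S q.1) ζ (dirDeriv b F α q.2 η)
          + ζ (dirDeriv b F α q.2 (adStar 𝕜 (S q.1) η))) := by
  rw [dirDeriv_bilin, Pi.add_apply, bilin_apply, bilin_apply]
  simp only [LinearMap.add_apply, LinearMap.sum_apply, map_add, map_sum]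
  congr 1
  refine Finset.sum_congr rfl fun q _ => ?_
  rw [adjAction_apply, map_add]; rfl

variable {b}

/-- Infinitesimal gauge transformations act on the defect of the dynamical Yang--Baxter equation
by the adjoint action. -/
theorem cyclic_cdybeVariation_gauge (hϖ : ∀ z ∈ l, G.ϖ z = 0) {S : FormalMap ι g}
    (hS : IsEquivariant b S) {F : FormalMap ι (Dual 𝕜 g →ₗ[𝕜] g)} (hF : IsEquivariantMatrix b F)
    (hskew : ∀ n, IsSkew (F n)) (ξ η ζ : Dual 𝕜 g) (n : ι →₀ ℕ) :
    cdybeVariation G b F (bilin (adjAction 𝕜 g) S F + gaugeSource G b S) ξ η ζ n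
      + cdybeVariation G b F (bilin (adjAction 𝕜 g) S F + gaugeSource G b S) η ζ ξ n
      + cdybeVariation G b F (bilin (adjAction 𝕜 g) S F + gaugeSource G b S) ζ ξ η n
      = ∑ q ∈ antidiagonal n, (cdybeDefect G b F (adStar 𝕜 (S q.1) ξ) η ζ q.2
        + cdybeDefect G b F ξ (adStar 𝕜 (S q.1) η) ζ q.2
        + cdybeDefect G b F ξ η (adStar 𝕜 (S q.1) ζ) q.2) := by
  -- The bracket with dS i* - i (dS)* acts on F in two ways. The part ρ_(dS i*ξ) F cancels the
  -- derivative of S in d(ρ_S F); the part from i (dS)* supplies dF(i* ad*_S ξ), by `hC`.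
  have hK : ∀ ξ η ζ : Dual 𝕜 g, ∀ q : (ι →₀ ℕ) × (ι →₀ ℕ),
      ζ (adjAction 𝕜 g (map (skewPart l) (differential b S) q.1 ξ) (F q.2) η)
      = ζ (adjAction 𝕜 g (differential b S q.1 (restrictDual l ξ)) (F q.2) η)
        - ζ (adjAction 𝕜 g (dualVec (differential b S q.1) ξ : g) (F q.2) η) := by
    intro ξ η ζ q
    rw [map_apply, skewPart_apply, map_sub, LinearMap.sub_apply, LinearMap.sub_apply, map_sub]
    rfl
  have hC : ∀ ξ η ζ : Dual 𝕜 g, ∑ q ∈ antidiagonal n,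
      ζ (adjAction 𝕜 g (dualVec (differential b S q.1) ξ : g) (F q.2) η)
      = ∑ q ∈ antidiagonal n, ζ (dirDeriv b F (restrictDual l (adStar 𝕜 (S q.1) ξ)) q.2 η) := by
    intro ξ η ζ
    have := congrArg (fun t => ζ (t η)) (hF.sum_adjAction_dualVec hS ξ n)
    simpa only [LinearMap.sum_apply, map_sum] using this
  -- The image of i (dS)* lies in l, where ϖ vanishes.
  have hW : ∀ ξ η ζ : Dual 𝕜 g, ζ (G.ϖ (map (skewPart l) (differential b S) n ξ) η)
      = ζ (G.ϖ (differential b S n (restrictDual l ξ)) η) := by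
    intro ξ η ζ
    rw [map_apply, skewPart_apply, map_sub, inclAdjoint_apply, hϖ _ (dualVec _ ξ).2, sub_zero]
  -- Skewness of F removes the right-hand side of `cyclic_adjAction_identity`.
  have hbr : (formalBracket (map (skewPart l) (differential b S)) F ξ η ζ n
        + formalBracket F (map (skewPart l) (differential b S)) ξ η ζ n)
      + (formalBracket (map (skewPart l) (differential b S)) F η ζ ξ n
        + formalBracket F (map (skewPart l) (differential b S)) η ζ ξ n)
      + (formalBracket (map (skewPart l) (differential b S)) F ζ ξ η n
        + formalBracket F (map (skewPart l) (differential b S)) ζ ξ η n)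
      = ∑ q ∈ antidiagonal n, (ζ (adjAction 𝕜 g (map (skewPart l) (differential b S) q.1 ξ)
          (F q.2) η)
        + ξ (adjAction 𝕜 g (map (skewPart l) (differential b S) q.1 η) (F q.2) ζ)
        + η (adjAction 𝕜 g (map (skewPart l) (differential b S) q.1 ζ) (F q.2) ξ)) := by
    simp only [formalBracket_add_swap, ← Finset.sum_add_distrib]
    refine Finset.sum_congr rfl fun q _ => ?_
    have := cyclic_adjAction_identity (F q.2) (map (skewPart l) (differential b S) q.1) ξ η ζ
    rw [hskew q.2 ζ, hskew q.2 ξ, hskew q.2 η] at this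
    linear_combination this
  have hcoc := cyclic_cdybeVariation_cocycle G (S := S) F ξ η ζ n
  have hjac := G.cyclic_jacobi (S n) ξ η ζ
  have hdd := cyclic_skewPart_differential b S ξ η ζ n
  have hφ1 := sum_antidiagonal_const (fun k => G.φ ![adStar 𝕜 (S k) ξ, η, ζ]) n
  have hφ2 := sum_antidiagonal_const (fun k => G.φ ![ξ, adStar 𝕜 (S k) η, ζ]) n
  have hφ3 := sum_antidiagonal_const (fun k => G.φ ![ξ, η, adStar 𝕜 (S k) ζ]) n
  have hb1 := formalBracket_adjAction S F ξ η ζ n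
  have hb2 := formalBracket_adjAction S F η ζ ξ n
  have hb3 := formalBracket_adjAction S F ζ ξ η n
  simp only [gaugeSource, cdybeVariation_add, Pi.add_apply]
  simp only [cdybeVariation, cdybeDefect, Pi.add_apply, Pi.sub_apply, cdybeTerm_apply,
    dual_dirDeriv_adjAction, hW]
  simp only [hK, Finset.sum_add_distrib, Finset.sum_sub_distrib, hC] at hbr hcoc hb1 hb2 hb3 ⊢
  simp only [dirDeriv_map, map_apply] at hdd ⊢
  have hm : ∀ α : Dual 𝕜 l, dirDeriv b S α n = differential b S n α := fun _ => rfl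
  simp only [hm]
  -- In `hφ1`, `hφ2`, `hφ3` the constant φ is written as a convolution, so that the φ terms from
  -- `hjac` take the form of the constant term of the defect.
  linear_combination hdd - hbr - hcoc - hjac - hb1 - hb2 - hb3 + hφ1 + hφ2 + hφ3

end Formal

/-! ### Stability of skew-symmetry. -/

section Skew

variable {𝕜 : Type*} [Field 𝕜] {g : Type*} [AddCommGroup g] [Module 𝕜 g]

/-- The submodule of skew-symmetric maps `g* → g`. -/
def skewSubmodule (𝕜 g : Type*) [Field 𝕜] [AddCommGroup g] [Module 𝕜 g] :
    Submodule 𝕜 (Dual 𝕜 g →ₗ[𝕜] g) where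
  carrier := {t | IsSkew t}
  zero_mem' := fun ξ η => by simp
  add_mem' := fun {s t} hs ht ξ η => by
    simp only [LinearMap.add_apply, map_add, hs ξ η, ht ξ η]; ring
  smul_mem' := fun c t ht ξ η => by
    simp only [LinearMap.smul_apply, map_smul, ht ξ η, smul_neg]

theorem FormalMap.series_mem {ι V : Type*} [DecidableEq ι] [AddCommGroup V] [Module 𝕜 V]
    (P : Submodule 𝕜 V) {T : FormalMap ι (V →ₗ[𝕜] V)} (hT : ∀ n, ∀ v ∈ P, T n v ∈ P) (c : ℕ → 𝕜)
    (n : ι →₀ ℕ) {v : V} (hv : v ∈ P) : series c T n v ∈ P := by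
  have hpow : ∀ k n, ∀ v ∈ P, pow T k n v ∈ P := by
    intro k
    induction k with
    | zero =>
      intro n v hv
      change const ι (LinearMap.id (R := 𝕜)) n v ∈ P
      rw [const_apply]
      split_ifs
      · exact hv
      · exact P.zero_mem
    | succ k ih =>
      intro n v hv
      change comp T (pow T k) n v ∈ P
      rw [comp_apply, LinearMap.sum_apply]
      exact P.sum_mem fun q _ => hT _ _ (ih _ _ hv)
  rw [series, LinearMap.sum_apply]
  exact P.sum_mem fun k _ => P.smul_mem _ (hpow k n v hv)

end Skew

/-! ### Gauge transformations preserve dynamical matrices. -/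

section Flow

open Finset.HasAntidiagonal (antidiagonal mem_antidiagonal)

variable {𝕜 : Type*} [RCLike 𝕜] {g : Type*} [LieRing g] [LieAlgebra 𝕜 g]
  [FiniteDimensional 𝕜 g] {l : LieSubalgebra 𝕜 g} {ι : Type*} [Fintype ι] [DecidableEq ι]
  {b : Basis ι 𝕜 l} (G : LieQuasiBialgebra 𝕜 g)

theorem isSkew_affineFlow {S : FormalMap ι g} {r c : FormalMap ι (Dual 𝕜 g →ₗ[𝕜] g)}
    (hr : ∀ n, IsSkew (r n)) (hc : ∀ n, IsSkew (c n)) (t : 𝕜) (n : ι →₀ ℕ) :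
    IsSkew (affineFlow (adjAction 𝕜 g) S r c t n) := by
  have hT : ∀ n, ∀ v ∈ skewSubmodule 𝕜 g, map (adjAction 𝕜 g) S n v ∈ skewSubmodule 𝕜 g :=
    fun n v hv => IsSkew.adjAction hv _
  change affineFlow (adjAction 𝕜 g) S r c t n ∈ skewSubmodule 𝕜 g
  rw [affineFlow, Pi.add_apply, apply_apply, apply_apply]
  exact Submodule.add_mem _ (Submodule.sum_mem _ fun q _ => series_mem _ hT _ _ (hr q.2))
    (Submodule.sum_mem _ fun q _ => series_mem _ hT _ _ (hc q.2))

theorem isSkew_gaugeSource (S : FormalMap ι g) (n : ι →₀ ℕ) : IsSkew (gaugeSource G b S n) :=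
  (skewSubmodule 𝕜 g).add_mem (isSkew_skewPart _) (G.skew _)

theorem hasWeakDerivAt_cdybeTerm {F : 𝕜 → FormalMap ι (Dual 𝕜 g →ₗ[𝕜] g)}
    {F' : FormalMap ι (Dual 𝕜 g →ₗ[𝕜] g)} {t : 𝕜}
    (hF : ∀ n, HasWeakDerivAt (fun s => F s n) (F' n) t) (ξ η ζ : Dual 𝕜 g) (n : ι →₀ ℕ) :
    HasWeakDerivAt (fun s => cdybeTerm G b (F s) ξ η ζ n)
      (cdybeVariation G b (F t) F' ξ η ζ n) t := by
  simp only [cdybeTerm_apply, cdybeVariation]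
  have hev : ∀ α : Dual 𝕜 g, ∀ n, HasWeakDerivAt (fun s => F s n α) (F' n α) t :=
    fun α n => (hF n).map (LinearMap.applyₗ α)
  refine ((HasWeakDerivAt.map (ζ ∘ₗ LinearMap.applyₗ η)
    (hasWeakDerivAt_dirDeriv b hF (restrictDual l ξ) n)).sub ?_).sub
    ((hev ξ n).map (ζ ∘ₗ LinearMap.applyₗ η ∘ₗ G.ϖ))
  refine (HasWeakDerivAt.sum fun q _ => (hev ξ q.1).bilin
    ((LieAlgebra.ad 𝕜 g : g →ₗ[𝕜] g →ₗ[𝕜] g).compr₂ ζ) (hev η q.2)).congr_deriv ?_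
  rw [Finset.sum_add_distrib]
  rfl

/-- Since ϖ vanishes on l, the equivariance condition becomes linear and homogeneous, so differences
and homogeneous components inherit it. -/
theorem isFormalDynamicalMatrix_iff (hϖ : ∀ z ∈ l, G.ϖ z = 0)
    (r : FormalMap ι (Dual 𝕜 g →ₗ[𝕜] g)) :
    IsFormalDynamicalMatrix G b r ↔ (∀ n, IsSkew (r n)) ∧
      (∀ ξ η ζ, cdybeDefect G b r ξ η ζ = 0) ∧ IsEquivariantMatrix b r := by
  have h0 : ∀ z : l, const ι (G.ϖ z) = 0 := by
    intro z
    funext n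
    simp [const_apply, hϖ z z.2]
  refine ⟨fun h => ⟨h.skew, fun ξ η ζ => ?_, fun z => ?_⟩, fun ⟨h1, h2, h3⟩ => ⟨h1, ?_, ?_⟩⟩
  · rw [cdybeDefect, h.cdybe, sub_self]
  · have := h.equivariant z
    rwa [h0, add_zero] at this
  · intro ξ η ζ
    exact sub_eq_zero.1 (h2 ξ η ζ)
  · intro z
    rw [h0, add_zero]
    exact h3 z

/-- Gauge transformations preserve formal dynamical matrices. -/
theorem IsFormalDynamicalMatrix.affineFlow (hϖ : ∀ z ∈ l, G.ϖ z = 0) {S : FormalMap ι g}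
    (hS0 : S 0 = 0) (hS : IsEquivariant b S) {r : FormalMap ι (Dual 𝕜 g →ₗ[𝕜] g)}
    (hr : IsFormalDynamicalMatrix G b r) (t : 𝕜) :
    IsFormalDynamicalMatrix G b (affineFlow (adjAction 𝕜 g) S r (gaugeSource G b S) t) := by
  rw [isFormalDynamicalMatrix_iff G hϖ] at hr ⊢
  obtain ⟨h1, h2, h3⟩ := hr
  have hskew := fun t => isSkew_affineFlow (S := S) h1 (isSkew_gaugeSource (b := b) G S) t
  have heq := fun t => h3.affineFlow hS0 hS (hS.gaugeSource G hϖ) t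
  refine ⟨hskew t, fun ξ η ζ => ?_, heq t⟩
  -- The induction on the degree treats all t and all arguments at once, because the derivative
  -- involves lower coefficients at the same t but at other arguments.
  have key : ∀ N : ℕ, ∀ n : ι →₀ ℕ, n.degree = N → ∀ t ξ η ζ,
      cdybeDefect G b (_root_.affineFlow (adjAction 𝕜 g) S r (gaugeSource G b S) t) ξ η ζ n
        = 0 := by
    intro N
    induction N using Nat.strong_induction_on with
    | _ N ih =>
      intro n hn t ξ η ζ
      have hconst := HasWeakDerivAt.eq_const (f := fun s => cdybeDefect G b
        (_root_.affineFlow (adjAction 𝕜 g) S r (gaugeSource G b S) s) ξ η ζ n) (fun s => ?_) t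
      · rw [hconst, affineFlow_zero, h2]; rfl
      · have hd := hasWeakDerivAt_affineFlow (adjAction 𝕜 g) hS0 r (gaugeSource G b S) s
        refine ((((hasWeakDerivAt_cdybeTerm G hd ξ η ζ n).add
          (hasWeakDerivAt_cdybeTerm G hd η ζ ξ n)).add
          (hasWeakDerivAt_cdybeTerm G hd ζ ξ η n)).sub
          (HasWeakDerivAt.const (const ι (G.φ ![ξ, η, ζ]) n) s)).congr_deriv ?_
        rw [sub_zero, cyclic_cdybeVariation_gauge G hϖ hS (heq s) (hskew s)]
        refine Finset.sum_eq_zero fun q hq => ?_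
        -- If `q.1 = 0`, then S_0 = 0 puts a zero argument into each defect, which is linear in each
        -- argument. Otherwise `q.2` has lower degree and the induction hypothesis applies.
        by_cases hq1 : q.1 = 0
        · have h0 : ∀ α : Dual 𝕜 g, adStar 𝕜 (0 : g) α = 0 := by
            intro α; ext y; simp [adStar_apply]
          have hn2 : q.2 = n := by
            have := mem_antidiagonal.1 hq
            rwa [hq1, zero_add] at this
          rw [hq1, hS0, h0, h0, h0]
          simp only [cdybeDefect, Pi.add_apply, Pi.sub_apply, cdybeTerm_apply, formalBracket,
            map_zero, LinearMap.zero_apply, lie_zero, zero_lie, Finset.sum_const_zero, const_apply]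
          rw [G.φ.map_coord_zero (m := ![0, η, ζ]) 0 rfl, G.φ.map_coord_zero (m := ![ξ, 0, ζ]) 1 rfl,
            G.φ.map_coord_zero (m := ![ξ, η, 0]) 2 rfl]
          have hdz : ∀ (M : FormalMap ι (Dual 𝕜 g →ₗ[𝕜] g)) k, dirDeriv b M 0 k = 0 := by
            intro M k
            exact LinearMap.map_zero _
          simp [hdz]
        · have hdeg := degree_add_degree hq
          have hq0 : q.1.degree ≠ 0 := by simpa [Finsupp.degree_eq_zero_iff] using hq1
          have := ih q.2.degree (by omega) q.2 rfl s
          rw [this, this, this, add_zero, add_zero]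
  funext n
  exact key _ n rfl t ξ η ζ

/-- Linear equivariance of the logarithm gives an element of the gauge group. -/
def GaugeMap.ofLog (S : FormalMap ι g) (hS0 : S 0 = 0) (hS : IsEquivariant b S) :
    GaugeMap b where
  log := S
  log_zero := hS0
  equivariant := fun z => by
    have h : apply (differential b S) (adStarPoint b z)
        = apply (formalAdjoint (𝕜 := 𝕜) S) (const ι (z : g)) := by
      funext n
      rw [apply_const]
      exact hS z n
    have h' : formalAd (𝕜 := 𝕜) S = exp (formalAdjoint (𝕜 := 𝕜) S) := rfl
    have h'' : rightLogDeriv b S = comp (expDiv (formalAdjoint (𝕜 := 𝕜) S)) (differential b S) := rfl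
    -- Apply (e^T - 1)/T to dS(ad*_z p) = T z, where T = ad_S; the result is (e^T - 1) z.
    rw [h'', apply_comp, h, h', ← apply_comp, ← expDiv_comm (formalAdjoint_zero (𝕜 := 𝕜) hS0),
      exp_eq_add (formalAdjoint_zero (𝕜 := 𝕜) hS0), FormalMap.add_apply, const_id_apply,
      add_sub_cancel_left]

theorem gaugeTransform_ofLog {S : FormalMap ι g} (hS0 : S 0 = 0) (hS : IsEquivariant b S)
    (r : FormalMap ι (Dual 𝕜 g →ₗ[𝕜] g)) :
    gaugeTransform G b (GaugeMap.ofLog S hS0 hS) r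
      = affineFlow (adjAction 𝕜 g) S r (gaugeSource G b S) 1 :=
  gaugeTransform_eq_affineFlow G hS0 hS r

/-- The effect of changing the top degree coefficients of the logarithm. -/
theorem affineFlow_sub_affineFlow {S S' : FormalMap ι g} {N : ℕ}
    (h : ∀ n : ι →₀ ℕ, n.degree ≤ N → S n = S' n) (r : FormalMap ι (Dual 𝕜 g →ₗ[𝕜] g))
    {n : ι →₀ ℕ} (hn : n.degree ≤ N) :
    affineFlow (adjAction 𝕜 g) S' r (gaugeSource G b S') 1 n
      - affineFlow (adjAction 𝕜 g) S r (gaugeSource G b S) 1 n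
      = skewPart l (differential b S' n - differential b S n) := by
  have hT : ∀ k : ι →₀ ℕ, k.degree ≤ N → map (adjAction 𝕜 g) S k = map (adjAction 𝕜 g) S' k := by
    intro k hk; rw [map_apply, map_apply, h k hk]
  -- Up to degree N the terms ϖ_S and ϖ_S' coincide; only the differential sees degree N + 1.
  have hsrc : ∀ k : ι →₀ ℕ, k.degree ≤ N → gaugeSource G b S' k - gaugeSource G b S k
      = skewPart l (differential b S' k - differential b S k) := by
    intro k hk
    simp only [gaugeSource, Pi.add_apply, map_apply, h k hk, map_sub]
    abel
  simp only [affineFlow, Pi.add_apply, apply_apply]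
  have hexp : ∀ c : ℕ → 𝕜, ∀ q ∈ antidiagonal n, series c (map (adjAction 𝕜 g) S') q.1
      = series c (map (adjAction 𝕜 g) S) q.1 := by
    intro c q hq
    have := degree_add_degree hq
    exact (series_congr c hT (by omega)).symm
  rw [Finset.sum_congr rfl (g := fun q => flow (map (adjAction 𝕜 g) S) 1 q.1 (r q.2))
    (fun q hq => by rw [flow, hexp _ q hq]; rfl), add_sub_add_left_eq_sub,
    ← Finset.sum_sub_distrib]
  rw [Finset.sum_congr rfl (g := fun q => flowIntegral (map (adjAction 𝕜 g) S) 1 q.1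
    (gaugeSource G b S' q.2 - gaugeSource G b S q.2))
    (fun q hq => by rw [flowIntegral, hexp _ q hq, map_sub]; rfl)]
  -- In every other term the source is taken in degree below N, where dS and dS' still agree. The
  -- remaining factor is the constant term 1 of (e^ρ - 1)/ρ.
  rw [sum_antidiagonal_eq_zero_left (fun x y => flowIntegral (map (adjAction 𝕜 g) S) 1 x
    (gaugeSource G b S' y - gaugeSource G b S y))]
  · rw [flowIntegral_one, expDiv_apply_zero, LinearMap.id_apply, hsrc n hn]
  · intro q hq hq1
    have hdeg := degree_add_degree hq
    have hq0 : q.1.degree ≠ 0 := by simpa [Finsupp.degree_eq_zero_iff] using hq1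
    rw [hsrc _ (by omega), differential_congr b (G := S) fun k hk => (h k (by omega)).symm,
      sub_self, map_zero, map_zero]

end Flow

/-! ### The equivariant Poincaré lemma. -/

section Homotopy

open Finset.HasAntidiagonal (antidiagonal mem_antidiagonal)

/-- A linear vector field preserves the degree. -/
theorem FormalMap.fieldDeriv_congr {𝕜 : Type*} [Field 𝕜] {ι : Type*} [Fintype ι] [DecidableEq ι]
    {E V : Type*} [AddCommGroup E] [Module 𝕜 E] [AddCommGroup V] [Module 𝕜 V] (b : Basis ι 𝕜 E)
    {P : FormalMap ι (Dual 𝕜 E)} (hP : ∀ n : ι →₀ ℕ, n.degree ≠ 1 → P n = 0)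
    {F F' : FormalMap ι V} {n : ι →₀ ℕ} (h : ∀ k : ι →₀ ℕ, k.degree = n.degree → F k = F' k) :
    fieldDeriv b P F n = fieldDeriv b P F' n := by
  rw [fieldDeriv_apply, fieldDeriv_apply]
  refine Finset.sum_congr rfl fun q hq => ?_
  rw [← differential_apply, ← differential_apply]
  by_cases h2 : q.2.degree = 1
  · have := degree_add_degree hq
    rw [differential_congr b fun k hk => h k (by omega)]
  · rw [hP _ h2, map_zero, map_zero]

theorem FormalMap.fieldDeriv_point_right {𝕜 : Type*} [Field 𝕜] {ι : Type*} [Fintype ι]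
    [DecidableEq ι] {E : Type*} [AddCommGroup E] [Module 𝕜 E] (b : Basis ι 𝕜 E)
    (P : FormalMap ι (Dual 𝕜 E)) : fieldDeriv b P (point b) = P := by
  funext n
  rw [fieldDeriv_apply]
  simp only [dirDeriv_point]
  rw [sum_antidiagonal_comm (fun x y => const ι (P y) x), sum_antidiagonal_const]

variable {𝕜 : Type*} [RCLike 𝕜] {g : Type*} [LieRing g] [LieAlgebra 𝕜 g]
  [FiniteDimensional 𝕜 g] {l : LieSubalgebra 𝕜 g} {m : Submodule 𝕜 g}
  {ι : Type*} [Fintype ι] [DecidableEq ι] {b : Basis ι 𝕜 l}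

theorem adStarPoint_eq_zero (z : l) {n : ι →₀ ℕ} (hn : n.degree ≠ 1) :
    adStarPoint b z n = 0 := by
  rw [adStarPoint, map_apply, point_eq_zero b hn, map_zero]

namespace IsReductiveDecomposition

variable (hlm : IsReductiveDecomposition l m)

/-- The projection of `g` onto `l` along `m`. -/
def proj : g →ₗ[𝕜] l := Submodule.projectionOnto l.toSubmodule m hlm.isCompl

theorem proj_coe (z : l) : hlm.proj (z : g) = z :=
  Submodule.projectionOnto_apply_left hlm.isCompl z

/-- This is where [l, m] ⊂ m enters: ad_z keeps the m-part of x in m. It makes `extend` and `scale`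
equivariant. -/
theorem proj_lie (z : l) (x : g) : hlm.proj ⁅(z : g), x⁆ = ⁅z, hlm.proj x⁆ := by
  have h1 : x - hlm.proj x ∈ m := by
    rw [← Submodule.projectionOnto_apply_eq_zero_iff hlm.isCompl]
    change hlm.proj (x - hlm.proj x) = 0
    rw [map_sub, hlm.proj_coe, sub_self]
  have h2 : hlm.proj ⁅(z : g), x - hlm.proj x⁆ = 0 :=
    (Submodule.projectionOnto_apply_eq_zero_iff hlm.isCompl).2 (hlm.lie_mem z z.2 _ h1)
  rw [lie_sub, map_sub, sub_eq_zero] at h2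
  rw [h2]
  exact hlm.proj_coe ⁅z, hlm.proj x⁆

/-- The inclusion `l* → g*` whose image annihilates `m`. -/
def extend : Dual 𝕜 l →ₗ[𝕜] Dual 𝕜 g := hlm.proj.dualMap

theorem restrictDual_extend (α : Dual 𝕜 l) : restrictDual l (hlm.extend α) = α := by
  ext z
  exact congrArg α (hlm.proj_coe z)

theorem extend_adStar (z : l) (α : Dual 𝕜 l) :
    hlm.extend (adStar 𝕜 z α) = adStar 𝕜 (z : g) (hlm.extend α) := by
  ext x
  exact congrArg α (hlm.proj_lie z x).symm

/-- The endomorphism of `g` that is multiplication by `a` on `m` and by `c` on `l`. -/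
def scale (a c : 𝕜) : g →ₗ[𝕜] g :=
  a • (LinearMap.id - l.toSubmodule.subtype ∘ₗ hlm.proj) + c • l.toSubmodule.subtype ∘ₗ hlm.proj

theorem scale_lie (a c : 𝕜) (z : l) (x : g) :
    hlm.scale a c ⁅(z : g), x⁆ = ⁅(z : g), hlm.scale a c x⁆ := by
  have h : ∀ y, hlm.scale a c y = a • (y - (hlm.proj y : g)) + c • (hlm.proj y : g) :=
    fun _ => rfl
  rw [h, h, hlm.proj_lie]
  simp

theorem dual_scale (a c : 𝕜) (η : Dual 𝕜 g) (x : g) :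
    η (hlm.scale a c x) = a * (η x - hlm.extend (restrictDual l η) x)
      + c * hlm.extend (restrictDual l η) x := by
  have h : hlm.scale a c x = a • (x - (hlm.proj x : g)) + c • (hlm.proj x : g) := rfl
  rw [h, map_add, map_smul, map_smul, map_sub]
  rfl

variable (b)

/-- The contraction of a homogeneous formal map of degree `N` with the tautological map, up to
scaling. -/
def homotopy (N : ℕ) (F : FormalMap ι (Dual 𝕜 g →ₗ[𝕜] g)) : FormalMap ι g :=
  map (hlm.scale ((N : 𝕜) + 1)⁻¹ ((N : 𝕜) + 2)⁻¹) (apply F (map hlm.extend (point b)))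

variable {b}

theorem homotopy_eq_zero {N : ℕ} {F : FormalMap ι (Dual 𝕜 g →ₗ[𝕜] g)}
    (hF : ∀ n : ι →₀ ℕ, n.degree ≠ N → F n = 0) {n : ι →₀ ℕ} (hn : n.degree ≠ N + 1) :
    hlm.homotopy b N F n = 0 := by
  rw [homotopy, map_apply, apply_apply, Finset.sum_eq_zero, map_zero]
  intro q hq
  have := degree_add_degree hq
  by_cases h : q.2.degree = 1
  · rw [hF _ (by omega), LinearMap.zero_apply]
  · rw [map_apply, point_eq_zero b h, map_zero, map_zero]

/-- The tautological map p ↦ p is equivariant, and so are `extend` and `scale`; contracting an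
equivariant F with them therefore gives an equivariant map. -/
theorem isEquivariant_homotopy (N : ℕ) {F : FormalMap ι (Dual 𝕜 g →ₗ[𝕜] g)}
    (hF : IsEquivariantMatrix b F) : IsEquivariant b (hlm.homotopy b N F) := by
  intro z n
  have h1 : fieldDeriv b (adStarPoint b z) (apply F (map hlm.extend (point b)))
      = - map (LieAlgebra.ad 𝕜 g z : g →ₗ[𝕜] g) (apply F (map hlm.extend (point b))) := by
    rw [apply, fieldDeriv_bilin, fieldDeriv_map, fieldDeriv_point_right,
      eq_neg_of_add_eq_zero_left (hF z)]
    funext k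
    rw [Pi.add_apply, Pi.neg_apply, map_apply, bilin_apply, bilin_apply, bilin_apply, map_sum,
      ← Finset.sum_add_distrib, ← Finset.sum_neg_distrib]
    refine Finset.sum_congr rfl fun q _ => ?_
    simp only [LinearMap.id_apply, Pi.neg_apply, map_apply, LinearMap.neg_apply, adjAction_apply,
      adStarPoint, hlm.extend_adStar, LieAlgebra.ad_apply]
    abel
  rw [homotopy, fieldDeriv_map, h1, map_apply, map_apply, Pi.neg_apply, map_neg, map_apply,
    LieAlgebra.ad_apply, hlm.scale_lie, lie_skew]

/-- A p-form with homogeneous coefficients of degree N has homotopy constant 1/(N + p). The mixed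
block of F is an m-valued 1-form and the ∧²l block a 2-form, whence the factors 1/(N + 1) on m and
1/(N + 2) on l. The ∧²m block is a 0-form; it vanishes because N ≠ 0. -/
theorem skewPart_differential_homotopy {N : ℕ} (hN : N ≠ 0)
    {F : FormalMap ι (Dual 𝕜 g →ₗ[𝕜] g)} (hskew : ∀ n, IsSkew (F n))
    (hclosed : ∀ (ξ η ζ : Dual 𝕜 g) (n : ι →₀ ℕ), ζ (dirDeriv b F (restrictDual l ξ) n η)
      + ξ (dirDeriv b F (restrictDual l η) n ζ) + η (dirDeriv b F (restrictDual l ζ) n ξ) = 0)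
    {n : ι →₀ ℕ} (hn : n.degree = N) :
    skewPart l (differential b (hlm.homotopy b N F) n) = F n := by
  have hN0 : (N : 𝕜) ≠ 0 := Nat.cast_ne_zero.2 hN
  have hN1 : (N : 𝕜) + 1 ≠ 0 := by exact_mod_cast Nat.succ_ne_zero N
  have hN2 : (N : 𝕜) + 2 ≠ 0 := by exact_mod_cast Nat.succ_ne_zero (N + 1)
  set Q := map hlm.extend (point b) with hQ
  -- The pairing of η with the derivative along i*ξ of the contraction, before scaling.
  let W : Dual 𝕜 g → Dual 𝕜 g → 𝕜 := fun ξ η => η (dirDeriv b (apply F Q) (restrictDual l ξ) n)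
  have hdskew : ∀ α k, IsSkew (dirDeriv b F α k) := by
    intro α k
    rw [dirDeriv_eq_sum]
    exact (skewSubmodule 𝕜 g).sum_mem fun i _ => Submodule.smul_mem _ _
      (Submodule.smul_mem _ _ (hskew _))
  have hQd : ∀ α, dirDeriv b Q α = const ι (hlm.extend α) := by
    intro α
    funext k
    rw [hQ, dirDeriv_map, dirDeriv_point]
    simp only [const_apply]
    split_ifs <;> simp
  have hW : ∀ ξ η, W ξ η = ∑ q ∈ antidiagonal n, η (dirDeriv b F (restrictDual l ξ) q.1 (Q q.2))
      + η (F n (hlm.extend (restrictDual l ξ))) := by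
    intro ξ η
    simp only [W]
    rw [apply, dirDeriv_bilin, hQd, Pi.add_apply, map_add, bilin_apply, map_sum, ← apply,
      apply_const]
    rfl
  have hEuler : ∀ ξ η : Dual 𝕜 g, ∑ q ∈ antidiagonal n, ξ (dirDeriv b F (point b q.2) q.1 η)
      = N * ξ (F n η) := by
    intro ξ η
    have := congrArg (fun t => ξ (t η)) (fieldDeriv_point b F n)
    simp only [fieldDeriv_apply, LinearMap.sum_apply, map_sum, LinearMap.smul_apply, map_smul,
      hn, smul_eq_mul] at this
    exact this
  -- Cartan's formula: closedness turns the antisymmetrised derivative of F into minus its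
  -- derivative along p, which Euler's identity evaluates.
  have hH : ∀ ξ η, W ξ η - W η ξ = - N * ξ (F n η) + η (F n (hlm.extend (restrictDual l ξ)))
      - ξ (F n (hlm.extend (restrictDual l η))) := by
    intro ξ η
    rw [hW, hW, neg_mul, ← hEuler]
    have : ∑ q ∈ antidiagonal n, η (dirDeriv b F (restrictDual l ξ) q.1 (Q q.2))
        - ∑ q ∈ antidiagonal n, ξ (dirDeriv b F (restrictDual l η) q.1 (Q q.2))
        = - ∑ q ∈ antidiagonal n, ξ (dirDeriv b F (point b q.2) q.1 η) := by
      rw [← Finset.sum_sub_distrib, ← Finset.sum_neg_distrib]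
      refine Finset.sum_congr rfl fun q _ => ?_
      have h1 := hclosed ξ (Q q.2) η q.1
      rw [hQ, map_apply, hlm.restrictDual_extend, hdskew _ _ _ ξ] at h1
      rw [hQ, map_apply]
      linear_combination h1
    linear_combination this
  have hr0 : ∀ ξ : Dual 𝕜 g,
      restrictDual l (ξ - hlm.extend (restrictDual l ξ)) = 0 := by
    intro ξ; rw [map_sub, hlm.restrictDual_extend, sub_self]
  have hW0 : ∀ ξ η, restrictDual l ξ = 0 → W ξ η = 0 := by
    intro ξ η h
    simp only [W, h]
    rw [← differential_apply, map_zero, map_zero]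
  have hWe : ∀ ξ η, W (hlm.extend (restrictDual l ξ)) η = W ξ η := by
    intro ξ η
    simp only [W, hlm.restrictDual_extend]
  ext ξ
  rw [← sub_eq_zero, ← Module.forall_dual_apply_eq_zero_iff 𝕜]
  intro η
  rw [map_sub, dual_skewPart, differential_apply, differential_apply, homotopy, dirDeriv_map,
    dirDeriv_map, hlm.dual_scale, hlm.dual_scale]
  have hWm : ∀ ξ η, W ξ (η - hlm.extend (restrictDual l η))
      = W ξ η - W ξ (hlm.extend (restrictDual l η)) := fun _ _ => rfl
  change _ * (W ξ η - W ξ (hlm.extend (restrictDual l η)))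
    + _ * W ξ (hlm.extend (restrictDual l η))
    - (_ * (W η ξ - W η (hlm.extend (restrictDual l ξ)))
      + _ * W η (hlm.extend (restrictDual l ξ))) - η (F n ξ) = 0
  rw [← hWm, ← hWm]
  -- Each form is split into a part vanishing on m and a part vanishing on l: `e1` and `e2` are the
  -- mixed blocks, `e3` is the ∧²l block, `e4` the ∧²m block.
  have e1 := hH (hlm.extend (restrictDual l ξ)) (η - hlm.extend (restrictDual l η))
  have e2 := hH (ξ - hlm.extend (restrictDual l ξ)) (hlm.extend (restrictDual l η))
  have e3 := hH (hlm.extend (restrictDual l ξ)) (hlm.extend (restrictDual l η))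
  have e4 := hH (ξ - hlm.extend (restrictDual l ξ)) (η - hlm.extend (restrictDual l η))
  rw [hWe, hW0 _ _ (hr0 η), hr0, hlm.restrictDual_extend, map_zero, map_zero, map_zero] at e1
  rw [hWe, hW0 _ _ (hr0 ξ), hr0, hlm.restrictDual_extend, map_zero, map_zero, map_zero] at e2
  rw [hWe, hWe, hlm.restrictDual_extend, hlm.restrictDual_extend] at e3
  rw [hW0 _ _ (hr0 η), hW0 _ _ (hr0 ξ), hr0, hr0, map_zero, map_zero, map_zero, map_zero] at e4
  set ξl := hlm.extend (restrictDual l ξ)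
  set ηl := hlm.extend (restrictDual l η)
  rw [hskew n _ ξl] at e1
  rw [hskew n ηl ξl] at e3
  -- On the ∧²m block both values of W vanish, which leaves N times the block.
  have e4' : (ξ - ξl) (F n (η - ηl)) = 0 := by
    have : (N : 𝕜) * (ξ - ξl) (F n (η - ηl)) = 0 := by linear_combination e4
    exact (mul_eq_zero.1 this).resolve_left hN0
  have e1' : W ξ (η - ηl) = - ((N : 𝕜) + 1) * ξl (F n (η - ηl)) := by linear_combination e1
  have e2' : W η (ξ - ξl) = ((N : 𝕜) + 1) * (ξ - ξl) (F n ηl) := by linear_combination -e2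
  have e3' : W ξ ηl - W η ξl = - ((N : 𝕜) + 2) * ξl (F n ηl) := by
    linear_combination e3
  have s := hskew n η ξ
  rw [e1', e2', s]
  have e5 : ((N : 𝕜) + 2)⁻¹ * W ξ ηl - ((N : 𝕜) + 2)⁻¹ * W η ξl = - ξl (F n ηl) := by
    rw [← mul_sub, e3']; field_simp
  have e6 : ∀ y : 𝕜, ((N : 𝕜) + 1)⁻¹ * (-((N : 𝕜) + 1) * y) = -y := by
    intro y; field_simp
  have e7 : ∀ y : 𝕜, ((N : 𝕜) + 1)⁻¹ * (((N : 𝕜) + 1) * y) = y := by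
    intro y; field_simp
  rw [e6, e7]
  simp only [LinearMap.sub_apply, map_sub] at e4' ⊢
  linear_combination e5 + e4'

end IsReductiveDecomposition

end Homotopy

/-! ### Construction of the gauge map degree by degree. -/

section Induction

open Finset.HasAntidiagonal (antidiagonal mem_antidiagonal)

variable {𝕜 : Type*} [RCLike 𝕜] {g : Type*} [LieRing g] [LieAlgebra 𝕜 g]
  [FiniteDimensional 𝕜 g] {G : LieQuasiBialgebra 𝕜 g} {l : LieSubalgebra 𝕜 g} {m : Submodule 𝕜 g}
  {ι : Type*} [Fintype ι] [DecidableEq ι] {b : Basis ι 𝕜 l}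
  {r r' : FormalMap ι (Dual 𝕜 g →ₗ[𝕜] g)}

/-- The homogeneous component of degree `N` of a formal map. -/
def FormalMap.component {V : Type*} [AddCommGroup V] (N : ℕ) (F : FormalMap ι V) :
    FormalMap ι V :=
  fun n => if n.degree = N then F n else 0

theorem FormalMap.component_of_eq {V : Type*} [AddCommGroup V] {N : ℕ} (F : FormalMap ι V)
    {n : ι →₀ ℕ} (hn : n.degree = N) : component N F n = F n := if_pos hn

theorem FormalMap.component_of_ne {V : Type*} [AddCommGroup V] {N : ℕ} (F : FormalMap ι V)
    {n : ι →₀ ℕ} (hn : n.degree ≠ N) : component N F n = 0 := if_neg hn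

theorem IsEquivariantMatrix.component {F : FormalMap ι (Dual 𝕜 g →ₗ[𝕜] g)}
    (hF : IsEquivariantMatrix b F) (N : ℕ) : IsEquivariantMatrix b (FormalMap.component N F) := by
  intro z
  funext n
  rw [Pi.add_apply, map_apply]
  by_cases hn : n.degree = N
  · rw [fieldDeriv_congr b (fun _ => adStarPoint_eq_zero z)
      fun k hk => component_of_eq F (hk.trans hn), component_of_eq F hn]
    exact congrFun (hF z) n
  · rw [fieldDeriv_congr b (fun _ => adStarPoint_eq_zero z) (F' := 0)
      fun k hk => component_of_ne F (hk ▸ hn), component_of_ne F hn, map_zero, fieldDeriv,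
      differential_zero, FormalMap.zero_apply]
    exact add_zero _

/-- The lowest order part of the difference of two formal dynamical matrices is closed. -/
theorem IsFormalDynamicalMatrix.closed_component (hr : IsFormalDynamicalMatrix G b r)
    (hr' : IsFormalDynamicalMatrix G b r') {k : ℕ}
    (h : ∀ n : ι →₀ ℕ, n.degree ≤ k → r n = r' n) (ξ η ζ : Dual 𝕜 g) (n : ι →₀ ℕ) :
    ζ (dirDeriv b (component (k + 1) (r' - r)) (restrictDual l ξ) n η)
      + ξ (dirDeriv b (component (k + 1) (r' - r)) (restrictDual l η) n ζ)
      + η (dirDeriv b (component (k + 1) (r' - r)) (restrictDual l ζ) n ξ) = 0 := by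
  simp only [← differential_apply]
  by_cases hn : n.degree = k
  · rw [differential_congr b fun j hj => component_of_eq (r' - r) (by omega)]
    -- In degree k the bracket and the ϖ term involve only coefficients of degree at most k, where r
    -- and r' agree.
    have hterm : ∀ ξ η ζ : Dual 𝕜 g, ζ (differential b (r' - r) n (restrictDual l ξ) η)
        = cdybeTerm G b r' ξ η ζ n - cdybeTerm G b r ξ η ζ n := by
      intro ξ η ζ
      have hbr : formalBracket r r ξ η ζ n = formalBracket r' r' ξ η ζ n := by
        refine Finset.sum_congr rfl fun q hq => ?_
        have := degree_add_degree hq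
        rw [h q.1 (by omega), h q.2 (by omega)]
      rw [cdybeTerm_apply, cdybeTerm_apply, hbr, h n hn.le, differential_sub]
      simp only [Pi.sub_apply, LinearMap.sub_apply, map_sub, differential_apply]
      ring
    have h1 := congrFun (hr.cdybe ξ η ζ) n
    have h2 := congrFun (hr'.cdybe ξ η ζ) n
    simp only [Pi.add_apply] at h1 h2
    rw [hterm, hterm, hterm]
    linear_combination h2 - h1
  · rw [differential_congr b (G := 0) fun j hj => component_of_ne (r' - r) (by omega), differential_zero]
    simp

/-- The inductive step: the gauge transformation can be corrected in the next degree. -/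
theorem exists_gauge_step (hlm : IsReductiveDecomposition l m) (hϖ : ∀ z ∈ l, G.ϖ z = 0)
    (hr : IsFormalDynamicalMatrix G b r) (hr' : IsFormalDynamicalMatrix G b r') (k : ℕ)
    {S : FormalMap ι g} (hS0 : S 0 = 0) (hS : IsEquivariant b S)
    (h : ∀ n : ι →₀ ℕ, n.degree ≤ k →
      affineFlow (adjAction 𝕜 g) S r (gaugeSource G b S) 1 n = r' n) :
    ∃ S' : FormalMap ι g, (S' 0 = 0 ∧ IsEquivariant b S' ∧ ∀ n : ι →₀ ℕ, n.degree ≤ k + 1 →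
        affineFlow (adjAction 𝕜 g) S' r (gaugeSource G b S') 1 n = r' n)
      ∧ ∀ n : ι →₀ ℕ, n.degree ≤ k + 1 → S n = S' n := by
  set L := affineFlow (adjAction 𝕜 g) S r (gaugeSource G b S) 1 with hL
  have hLdyn : IsFormalDynamicalMatrix G b L := hr.affineFlow G hϖ hS0 hS 1
  obtain ⟨hLs, -, hLe⟩ := (isFormalDynamicalMatrix_iff G hϖ L).1 hLdyn
  obtain ⟨hs', -, he'⟩ := (isFormalDynamicalMatrix_iff G hϖ r').1 hr'
  set Δ := component (k + 1) (r' - L) with hΔ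
  -- The correction has degree k + 2, one more than Δ, since it enters the transform through its
  -- differential.
  set s := hlm.homotopy b (k + 1) Δ with hs
  have hΔs : ∀ n, IsSkew (Δ n) := by
    intro n
    rw [hΔ, FormalMap.component]
    split_ifs
    · exact (skewSubmodule 𝕜 g).sub_mem (hs' n) (hLs n)
    · exact (skewSubmodule 𝕜 g).zero_mem
  have hs_deg : ∀ n : ι →₀ ℕ, n.degree ≠ k + 2 → s n = 0 := fun n hn =>
    hlm.homotopy_eq_zero (fun j hj => component_of_ne _ hj) hn
  have hs_eq : IsEquivariant b s :=
    hlm.isEquivariant_homotopy _ ((he'.sub hLe).component _)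
  have hagree : ∀ n : ι →₀ ℕ, n.degree ≤ k + 1 → S n = (S + s) n := by
    intro n hn
    rw [Pi.add_apply, hs_deg n (by omega), add_zero]
  refine ⟨S + s, ⟨?_, ?_, ?_⟩, hagree⟩
  · rw [← hagree 0 (by simp), hS0]
  · intro z n
    rw [fieldDeriv_add, Pi.add_apply, Pi.add_apply, hS, hs_eq, add_lie]
  · intro n hn
    have h1 := affineFlow_sub_affineFlow G (b := b) hagree r hn
    rw [differential_add, Pi.add_apply, add_sub_cancel_left] at h1
    rw [sub_eq_iff_eq_add.1 h1]
    change _ + L n = r' n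
    by_cases hk : n.degree = k + 1
    · rw [hs, hlm.skewPart_differential_homotopy (Nat.succ_ne_zero k) hΔs
        (hLdyn.closed_component hr' h) hk, hΔ, component_of_eq _ hk, Pi.sub_apply,
        sub_add_cancel]
    · rw [differential_congr b (G := 0) fun j hj => hs_deg j (by omega), differential_zero,
        Pi.zero_apply, map_zero, zero_add, h n (by omega)]

/-- Two formal dynamical matrices with the same value at `0` are gauge equivalent. -/
theorem exists_gauge_log (hlm : IsReductiveDecomposition l m) (hϖ : ∀ z ∈ l, G.ϖ z = 0)
    (hr : IsFormalDynamicalMatrix G b r) (hr' : IsFormalDynamicalMatrix G b r')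
    (h0 : r 0 = r' 0) :
    ∃ S : FormalMap ι g, S 0 = 0 ∧ IsEquivariant b S ∧
      affineFlow (adjAction 𝕜 g) S r (gaugeSource G b S) 1 = r' := by
  let P : ℕ → FormalMap ι g → Prop := fun k S => S 0 = 0 ∧ IsEquivariant b S ∧
    ∀ n : ι →₀ ℕ, n.degree ≤ k →
      affineFlow (adjAction 𝕜 g) S r (gaugeSource G b S) 1 n = r' n
  have hP0 : P 0 0 := by
    refine ⟨rfl, fun z n => ?_, fun n hn => ?_⟩
    · rw [fieldDeriv, differential_zero, FormalMap.zero_apply]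
      simp
    · rw [Nat.le_zero, Finsupp.degree_eq_zero_iff] at hn
      have hsrc : gaugeSource G b (0 : FormalMap ι g) = 0 := by
        rw [gaugeSource, differential_zero, map_zero_right, map_zero_right, add_zero]
      rw [hn, hsrc, affineFlow, apply_zero, add_zero, apply_apply, ← h0]
      simp [flow, series_apply_zero]
  choose! next hnext hagree using fun (k : ℕ) (S : FormalMap ι g) (hS : P k S) =>
    exists_gauge_step hlm hϖ hr hr' k hS.1 hS.2.1 hS.2.2
  let f : ℕ → FormalMap ι g := fun k => Nat.rec 0 (fun k S => next k S) k
  have hf : ∀ k, P k (f k) := by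
    intro k
    induction k with
    | zero => exact hP0
    | succ k ih => exact hnext k (f k) ih
  have hstep : ∀ k (n : ι →₀ ℕ), n.degree ≤ k + 1 → f k n = f (k + 1) n :=
    fun k => hagree k (f k) (hf k)
  have hstab : ∀ (n : ι →₀ ℕ) j, f n.degree n = f (n.degree + j) n := by
    intro n j
    induction j with
    | zero => rfl
    | succ j ih => rw [ih]; exact hstep _ n (by omega)
  -- Stages k and k + 1 agree through degree k + 1, so the coefficient at `n` no longer changes from
  -- stage `n.degree` on.
  let S : FormalMap ι g := fun n => f n.degree n
  have hS : ∀ k (n : ι →₀ ℕ), n.degree ≤ k + 1 → f k n = S n := by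
    intro k n hn
    rcases hn.lt_or_eq with h | h
    · obtain ⟨j, rfl⟩ := Nat.exists_eq_add_of_le (Nat.lt_succ_iff.1 h)
      exact (hstab n j).symm
    · rw [hstep k n hn, ← h]
  have hS0 : S 0 = 0 := by rw [← hS 0 0 (by simp), (hf 0).1]
  have hSeq : IsEquivariant b S := by
    intro z n
    rw [← hS n.degree n (by omega), ← (hf n.degree).2.1 z n]
    exact fieldDeriv_congr b (fun _ => adStarPoint_eq_zero z)
      fun k hk => (hS n.degree k (by omega)).symm
  refine ⟨S, hS0, hSeq, ?_⟩
  funext n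
  -- Stage `n.degree` agrees with S through degree `n.degree + 1`, which covers the extra degree
  -- needed by the differential in the source.
  rw [← (hf n.degree).2.2 n le_rfl, ← sub_eq_zero,
    affineFlow_sub_affineFlow G (fun k hk => hS n.degree k (by omega)) r le_rfl,
    differential_congr b fun k hk => (hS n.degree k hk.le).symm, sub_self, map_zero]

end Induction

end

theorem mainTheorem6 {𝕜 : Type*} [RCLike 𝕜] {g : Type*} [LieRing g] [LieAlgebra 𝕜 g]
    [FiniteDimensional 𝕜 g] (G : LieQuasiBialgebra 𝕜 g)
    (l : LieSubalgebra 𝕜 g) (m : Submodule 𝕜 g) (hlm : IsReductiveDecomposition l m)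
    (hϖ : ∀ z ∈ l, G.ϖ z = 0)
    {ι : Type*} [Fintype ι] [DecidableEq ι] (b : Module.Basis ι 𝕜 l)
    (r r' : FormalMap ι (Module.Dual 𝕜 g →ₗ[𝕜] g))
    (hr : IsFormalDynamicalMatrix G b r) (hr' : IsFormalDynamicalMatrix G b r')
    (h0 : r 0 = r' 0) :
    ∃ σ : GaugeMap b, gaugeTransform G b σ r = r' := by
  obtain ⟨S, hS0, hS, h⟩ := exists_gauge_log hlm hϖ hr hr' h0
  exact ⟨GaugeMap.ofLog S hS0 hS, (gaugeTransform_ofLog G hS0 hS r).trans h⟩
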